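/- **Setting.** Let $d,n\ge 1$ and let $(X_1,Y_1),\dots,(X_n,Y_n)$ be i.i.d. with law $P$ of a pair $(X,Y)\in\mathbb R^d\times\mathbb R$, $Y$ integrable, such that * $X$ has a density on $[0,1]^d$ (and no mass elsewhere) which is $\ge b>0$ on $[0,1]^d$; * $g(x)=\mathbb E[Y\mid X=x]$ is $L$-Lipschitz on $[0,1]^d$ for the Euclidean norm; * $\varepsilon=Y-g(X)$ satisfies $\mathbb E[\varepsilon\mid X]=0$ and $\mathbb E[e^{t\varepsilon}\mid X]\le e^{\sigma^2t^2/2}$ a.s. for all $t\in\mathbb R$. For a hyper-rectangle (cell) $V\subset[0,1]^d$ let $h_k(V)$ be its side lengths, $h_-(V)=\min_k h_k(V)$, $h_+(V)=\max_k h_k(V)$. A split $(p,u)\in\{1,\dots,d\}\times(0,1)$ cuts $V$ orthogonally to coordinate $p$ into a left and a right child whose $p$-th sides have lengths $u\,h_p(V)$ and $(1-u)h_p(V)$; points on the cut go to the left child. Let $S_\beta(V)$ be the set of splits whose two children satisfy $h_+\le\beta h_-$, and $S_m(V)$ the set of splits whose two children each contain at least $m$ of the points $X_1,\dots,X_n$.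 **CART-like tree** with parameters $m\ge 1$, $\beta\ge 2$ and an arbitrary real cost function $M_n((p,u),V)$, which may depend on the data. Start from the cell $[0,1]^d$. A cell $V$ with $S_m(V)=\emptyset$ is final. A cell $V$ with $S_m(V)\ne\emptyset$ is split by a minimizer of $M_n(\cdot,V)$ over $S_\beta(V)\cap S_m(V)$; if no minimizer exists, it is split in the middle of a largest side. Continue until all cells are final. For $x\in[0,1]^d$ let $\mathcal V(x)$ be the final cell containing $x$ and $$\hat g(x)=\frac{\sum_{i=1}^nY_i\mathbf 1_{\mathcal V(x)}(X_i)}{\sum_{i=1}^n\mathbf 1_{\mathcal V(x)}(X_i)},\qquad 0/0=0.$$ Call the realized tree *solvable* if, in every cell that was split, a minimizer of $M_n(\cdot,V)$ over $S_\beta(V)\cap S_m(V)$ exists, or at least the midpoint split used instead leaves at least $m$ sample points in each child. Let $L(\mathcal V(x))\ge 0$ be the smallest Lipschitz constant of $g$ on $\mathcal V(x)$. **Theorem.** Let $\delta\in(0,1/3)$ and $m\in\{1,\dots,n\}$ with $m\ge 4\log\big(4(2n+1)^{2d}/\delta\big)$. There is an event of probability at least $1-3\delta$ on which, whenever the tree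 is solvable, for all $x\in[0,1]^d$, $$|\hat g(x)-g(x)|\le\sqrt{\frac{2\sigma^2\log((n+1)^{2d}/\delta)}{m}}+L(\mathcal V(x))\,\beta\sqrt d\left(\frac{5m}{nb}\right)^{1/d},\qquad L(\mathcal V(x))\le L .$$ **Corollary.** For all $a_1,a_2>0$ there is a constant $C>0$, depending only on $a_1,a_2$, such that for all $d\ge1$ and $\delta\in(0,1/3)$ there is $n_0$, depending only on $a_1,a_2,d,\delta$, with the following property. If $n\ge n_0$ and the integer $m$ satisfies $$a_1 r_n\le m\le a_2 r_n,\qquad r_n=n^{2/(d+2)}\log\big((n+1)^{2d}/\delta\big)^{d/(d+2)},$$ then there is an event of probability at least $1-3\delta$ on which, whenever the tree is solvable, $$\sup_{x\in[0,1]^d}|\hat g(x)-g(x)|\le C\Big(\sqrt{2\sigma^2}+\beta L\sqrt d\,(5/b)^{1/d}\Big)\left(\frac{\log((n+1)^{2d}/\delta)}{n}\right)^{1/(d+2)}.$$ -/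

import Mathlib

open MeasureTheory ProbabilityTheory Set

universe u

/-- The covariate domain `[0,1]^d`, inside `ℝ^d` with its Euclidean norm. -/
def unitCube (d : ℕ) : Set (EuclideanSpace ℝ (Fin d)) :=
  {x | ∀ k, x k ∈ Icc (0 : ℝ) 1}

/-- `A` holds with probability at least `p` (no measurability of `A` itself is presupposed). -/
def HoldsWithProb {Ω : Type*} [MeasurableSpace Ω] (μ : Measure Ω) (p : ℝ) (A : Set Ω) : Prop :=
  ∃ E : Set Ω, E ⊆ A ∧ MeasurableSet E ∧ p ≤ μ.real E

/-! ### Local averages -/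

/-- `n P_n^X(A)`, the number of sample points in `A`. -/
noncomputable def empCount {d n : ℕ} (xs : Fin n → EuclideanSpace ℝ (Fin d))
    (A : Set (EuclideanSpace ℝ (Fin d))) : ℝ :=
  ∑ i, A.indicator (fun _ => (1 : ℝ)) (xs i)

/-- The local regression estimator of a local map `x ↦ 𝒱 x`, with the convention `0 / 0 = 0`. -/
noncomputable def localEstimator {d n : ℕ} (xs : Fin n → EuclideanSpace ℝ (Fin d))
    (ys : Fin n → ℝ) (𝒱 : EuclideanSpace ℝ (Fin d) → Set (EuclideanSpace ℝ (Fin d)))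
    (x : EuclideanSpace ℝ (Fin d)) : ℝ :=
  (∑ i, (𝒱 x).indicator (fun _ => ys i) (xs i)) / empCount xs (𝒱 x)

/-- The local Lipschitz constant of `g` over `V`. -/
noncomputable def localLip {d : ℕ} (g : EuclideanSpace ℝ (Fin d) → ℝ)
    (V : Set (EuclideanSpace ℝ (Fin d))) : ℝ :=
  sInf {K : ℝ | 0 ≤ K ∧ ∀ x ∈ V, ∀ y ∈ V, |g x - g y| ≤ K * ‖x - y‖}

/-! ### Cells and splits -/

/-- A hyper-rectangle, given by its lower and upper corners. -/
structure Cell (d : ℕ) where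
  lo : Fin d → ℝ
  hi : Fin d → ℝ

namespace Cell

variable {d n : ℕ}

/-- The points of a cell. A boundary point shared by two cells belongs to the lower one, so the
sides are `(lo, hi]`, except that they are closed at the boundary `0` of `[0,1]^d`. -/
def toSet (V : Cell d) : Set (EuclideanSpace ℝ (Fin d)) :=
  {x | ∀ k, (V.lo k < x k ∨ (V.lo k = 0 ∧ x k = 0)) ∧ x k ≤ V.hi k}

/-- The cell `[0,1]^d`. -/
def root (d : ℕ) : Cell d := ⟨fun _ => 0, fun _ => 1⟩

/-- The side length `h_k(V)`. -/
def side (V : Cell d) (k : Fin d) : ℝ := V.hi k - V.lo k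

/-- The smallest side length `h_-(V)`. -/
noncomputable def minSide (V : Cell d) : ℝ := ⨅ k, V.side k

/-- The largest side length `h_+(V)`. -/
noncomputable def maxSide (V : Cell d) : ℝ := ⨆ k, V.side k

/-- The position of the cut made by the split `(p, u)`. -/
def cut (V : Cell d) (s : Fin d × ℝ) : ℝ := V.lo s.1 + s.2 * V.side s.1

/-- The left child `V(l)`: its `p`-th side has length `u * h_p(V)`. -/
def left (V : Cell d) (s : Fin d × ℝ) : Cell d :=
  ⟨V.lo, Function.update V.hi s.1 (V.cut s)⟩

/-- The right child `V(r)`: its `p`-th side has length `(1 - u) * h_p(V)`. -/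
def right (V : Cell d) (s : Fin d × ℝ) : Cell d :=
  ⟨Function.update V.lo s.1 (V.cut s), V.hi⟩

/-- `β`-shape-regularity of a hyper-rectangle. -/
def ShapeRegular (β : ℝ) (V : Cell d) : Prop := V.maxSide ≤ β * V.minSide

/-- `S_β(V)`: the splits `(p, u)`, `0 < u < 1`, with two `β`-shape-regular children. -/
def shapeSplits (β : ℝ) (V : Cell d) : Set (Fin d × ℝ) :=
  {s | s.2 ∈ Ioo (0 : ℝ) 1 ∧ (V.left s).ShapeRegular β ∧ (V.right s).ShapeRegular β}

/-- `S_m(V)`: the splits `(p, u)`, `0 < u < 1`, with at least `m` sample points in each child. -/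
def countSplits (xs : Fin n → EuclideanSpace ℝ (Fin d)) (m : ℕ) (V : Cell d) :
    Set (Fin d × ℝ) :=
  {s | s.2 ∈ Ioo (0 : ℝ) 1 ∧ (m : ℝ) ≤ empCount xs (V.left s).toSet ∧
    (m : ℝ) ≤ empCount xs (V.right s).toSet}

/-- `s` minimizes the cost `M(·, V)` over `S_β(V) ∩ S_m(V)`. -/
def IsBestSplit (xs : Fin n → EuclideanSpace ℝ (Fin d)) (m : ℕ) (β : ℝ)
    (M : Fin d × ℝ → Cell d → ℝ) (V : Cell d) (s : Fin d × ℝ) : Prop :=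
  s ∈ V.shapeSplits β ∩ V.countSplits xs m ∧
    IsMinOn (fun t => M t V) (V.shapeSplits β ∩ V.countSplits xs m) s

/-- The split that the algorithm performs in `V` when `S_m(V) ≠ ∅`: a minimizer of the cost over
`S_β(V) ∩ S_m(V)`; if there is no minimizer, the middle of a largest side. -/
def IsChosenSplit (xs : Fin n → EuclideanSpace ℝ (Fin d)) (m : ℕ) (β : ℝ)
    (M : Fin d × ℝ → Cell d → ℝ) (V : Cell d) (s : Fin d × ℝ) : Prop :=
  V.IsBestSplit xs m β M s ∨
    ((¬ ∃ t, V.IsBestSplit xs m β M t) ∧ V.side s.1 = V.maxSide ∧ s.2 = 1 / 2)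

end Cell

/-! ### CART-like trees -/

/-- A finite binary tree that records, at each interior node, the split `(p, u)`. -/
inductive SplitTree (d : ℕ) where
  | leaf : SplitTree d
  | node (s : Fin d × ℝ) (l r : SplitTree d) : SplitTree d

namespace SplitTree

variable {d n : ℕ}

/-- `T` is the result of running the algorithm from the cell `V` until it stops: a cell is split,
by a split chosen as prescribed, exactly when `S_m` of the cell is nonempty. -/
def IsCart (xs : Fin n → EuclideanSpace ℝ (Fin d)) (m : ℕ) (β : ℝ)
    (M : Fin d × ℝ → Cell d → ℝ) : SplitTree d → Cell d → Prop
  | leaf, V => V.countSplits xs m = ∅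
  | node s l r, V => (V.countSplits xs m).Nonempty ∧ V.IsChosenSplit xs m β M s ∧
      IsCart xs m β M l (V.left s) ∧ IsCart xs m β M r (V.right s)

/-- In every cell that is split, the optimization problem has a solution, or at least the
midpoint split used instead leaves `m` sample points or more in each child. -/
def Solvable (xs : Fin n → EuclideanSpace ℝ (Fin d)) (m : ℕ) (β : ℝ)
    (M : Fin d × ℝ → Cell d → ℝ) : SplitTree d → Cell d → Prop
  | leaf, _ => True
  | node s l r, V => ((∃ t, V.IsBestSplit xs m β M t) ∨ s ∈ V.countSplits xs m) ∧
      Solvable xs m β M l (V.left s) ∧ Solvable xs m β M r (V.right s)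

/-- The final cell that contains `x`, when the tree is grown from the cell `V ∋ x`. -/
noncomputable def leafCell : SplitTree d → Cell d → EuclideanSpace ℝ (Fin d) → Cell d
  | leaf, V, _ => V
  | node s l r, V, x =>
      if x s.1 ≤ V.cut s then leafCell l (V.left s) x else leafCell r (V.right s) x

/-- The local map of a tree grown from `[0,1]^d`. -/
noncomputable def localMap (T : SplitTree d) (x : EuclideanSpace ℝ (Fin d)) :
    Set (EuclideanSpace ℝ (Fin d)) :=
  (T.leafCell (Cell.root d) x).toSet

end SplitTree

theorem Cell.toSet_root (d : ℕ) : (Cell.root d).toSet = unitCube d := by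
  ext x
  simp only [Cell.toSet, Cell.root, unitCube, mem_ofPred_eq, mem_Icc]
  refine forall_congr' fun k => and_congr_left fun _ => ?_
  rw [le_iff_lt_or_eq]
  simp [eq_comm]

theorem SplitTree.mem_leafCell {d : ℕ} (T : SplitTree d) (V : Cell d)
    (x : EuclideanSpace ℝ (Fin d)) (hx : x ∈ V.toSet) : x ∈ (T.leafCell V x).toSet := by
  induction T generalizing V with
  | leaf => exact hx
  | node s l r ihl ihr =>
    unfold SplitTree.leafCell
    split_ifs with h
    · refine ihl _ fun k => ⟨(hx k).1, ?_⟩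
      by_cases hk : k = s.1
      · subst hk; simpa [Cell.left] using h
      · simpa [Cell.left, hk] using (hx k).2
    · refine ihr _ fun k => ⟨?_, (hx k).2⟩
      by_cases hk : k = s.1
      · subst hk; left; simpa [Cell.right] using h
      · simpa [Cell.right, hk] using (hx k).1

/-- The map `x ↦ localMap T x` is a local map on `[0,1]^d`. -/
theorem SplitTree.mem_localMap {d : ℕ} (T : SplitTree d) (x : EuclideanSpace ℝ (Fin d))
    (hx : x ∈ unitCube d) : x ∈ T.localMap x :=
  T.mem_leafCell _ _ (by rwa [Cell.toSet_root])

/-! ### The regression model -/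

/-- Under the law `P` of `(X, Y)`, `g` is a version of `x ↦ 𝔼[Y | X = x]`. -/
def IsRegressionFunction {d : ℕ} (P : Measure (EuclideanSpace ℝ (Fin d) × ℝ))
    (g : EuclideanSpace ℝ (Fin d) → ℝ) : Prop :=
  Integrable (fun z => z.2) P ∧
    P[fun z => z.2 | MeasurableSpace.comap Prod.fst inferInstance] =ᵐ[P] fun z => g z.1

/-- Under the law `P` of `(X, Y)`, the noise `ε = Y - g(X)` is sub-Gaussian conditionally on `X`
with parameter `σ²`: `𝔼[ε | X] = 0` and `𝔼[exp(t ε) | X] ≤ exp(σ² t² / 2)` for all real `t`. -/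
def CondSubGaussianNoise {d : ℕ} (P : Measure (EuclideanSpace ℝ (Fin d) × ℝ))
    (g : EuclideanSpace ℝ (Fin d) → ℝ) (σ : ℝ) : Prop :=
  Integrable (fun z => z.2 - g z.1) P ∧
  P[fun z => z.2 - g z.1 | MeasurableSpace.comap Prod.fst inferInstance] =ᵐ[P] 0 ∧
  ∀ t : ℝ, Integrable (fun z => Real.exp (t * (z.2 - g z.1))) P ∧
    P[fun z => Real.exp (t * (z.2 - g z.1)) | MeasurableSpace.comap Prod.fst inferInstance]
      ≤ᵐ[P] fun _ => Real.exp (σ ^ 2 * t ^ 2 / 2)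

/-- Under the law `P` of `(X, Y)`, `X` has a density on `[0,1]^d` (and no mass elsewhere) that is
bounded from below by `b` there. -/
def DensityBoundedBelow {d : ℕ} (P : Measure (EuclideanSpace ℝ (Fin d) × ℝ)) (b : ℝ) : Prop :=
  ∃ f : EuclideanSpace ℝ (Fin d) → ENNReal, Measurable f ∧
    P.map Prod.fst = (volume.restrict (unitCube d)).withDensity f ∧
    ∀ x ∈ unitCube d, ENNReal.ofReal b ≤ f x

/-- The standing assumptions: an i.i.d. sample of law `P` satisfying the conditions above, an
`L`-Lipschitz regression function, and a (random) CART-like tree `T` grown from this sample with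
the (random) cost function `M`. -/
structure CartSetting {Ω : Type*} [MeasurableSpace Ω] (μ : Measure Ω) {d n : ℕ}
    (P : Measure (EuclideanSpace ℝ (Fin d) × ℝ)) (g : EuclideanSpace ℝ (Fin d) → ℝ)
    (σ : ℝ) (L : NNReal) (b β : ℝ) (m : ℕ)
    (X : Fin n → Ω → EuclideanSpace ℝ (Fin d)) (Y : Fin n → Ω → ℝ)
    (M : Ω → Fin d × ℝ → Cell d → ℝ) (T : Ω → SplitTree d) : Prop where
  law : ∀ i, HasLaw (fun ω => (X i ω, Y i ω)) P μ
  indep : iIndepFun (fun i ω => (X i ω, Y i ω)) μ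
  regression : IsRegressionFunction P g
  noise : CondSubGaussianNoise P g σ
  lipschitz : LipschitzOnWith L g (unitCube d)
  b_pos : 0 < b
  density : DensityBoundedBelow P b
  two_le_beta : 2 ≤ β
  tree : ∀ᵐ ω ∂μ, (T ω).IsCart (fun i => X i ω) m β (M ω) (Cell.root d)

/-! The tree and its cost may depend on the whole sample, so the estimates must hold simultaneously
for all cells. Two exceptional events suffice, and outside them the argument is deterministic up to
null sets.

Noise, probability at most `2 * δ`. The sample points in a cell are those whose coordinate ranks lie
in `d` prescribed intervals (`Cell.exists_mem_toSet_iff_mem_rankSelect`), so at most `(n + 1) ^ (2 *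
d)` selection rules occur. Each rule sees only the covariates. Given these, the noise sum over the
selected indices is sub-Gaussian, and a union bound over the rules gives `pi_measure_cell_noise_le`.

Mass, probability at most `δ`. A half-open box is approximated from inside by one of `(2 * n + 1) ^
(2 * d)` boxes with corners at marginal quantiles, at a loss of mass at most `d / n`. Chernoff's
bound for these boxes shows that every box with at most `2 * m` points has mass at most `5 * m / n`
(`pi_measure_light_box_heavy_mass_le`).

A final cell of a solvable tree is `β`-shape-regular and has at least `m` points
(`SplitTree.leafCell_properties`). It has fewer than `2 * m`, since otherwise a cut through a
suitable sample point would be admissible for `S_m` (`Cell.empCount_lt_of_countSplits_eq_empty`).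
The lower count bounds the averaged noise. The upper count bounds the mass, hence by the density
bound the volume, hence by regularity every side and the diameter. The bias is at most the local
Lipschitz constant times the diameter.

For the rate, with `l` the logarithm and `ρ = l / n`, the choice of `m` makes both terms of order `ρ
^ (1 / (d + 2))`; its side conditions hold for large `n` because `ρ` tends to zero. -/

section ProductBounds

/-! ### Conditional moment bounds on a product sample, without disintegration. -/

variable {α β : Type*} [MeasurableSpace α] [MeasurableSpace β]

theorem lintegral_fst_mul_le (P : Measure (α × β)) (f : α × β → ENNReal) (hf : Measurable f)
    (c : ENNReal)
    (hc : ∀ A, MeasurableSet A → ∫⁻ z in Prod.fst ⁻¹' A, f z ∂P ≤ c * P (Prod.fst ⁻¹' A))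
    (Ψ : α → ENNReal) (hΨ : Measurable Ψ) :
    ∫⁻ z, f z * Ψ z.1 ∂P ≤ c * ∫⁻ z, Ψ z.1 ∂P := by
  -- The hypothesis on preimages compares two measures on the first factor; integrating `Ψ` against
  -- both gives the claim.
  have hle : (P.withDensity f).map Prod.fst ≤ c • P.map Prod.fst := by
    refine Measure.le_iff.2 fun A hA => ?_
    rw [Measure.map_apply measurable_fst hA, withDensity_apply _ (measurable_fst hA),
      Measure.smul_apply, Measure.map_apply measurable_fst hA]
    exact hc A hA
  calc ∫⁻ z, f z * Ψ z.1 ∂P = ∫⁻ z, Ψ z.1 ∂(P.withDensity f) :=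
        (lintegral_withDensity_eq_lintegral_mul P hf (hΨ.comp measurable_fst)).symm
    _ = ∫⁻ x, Ψ x ∂((P.withDensity f).map Prod.fst) := (lintegral_map hΨ measurable_fst).symm
    _ ≤ ∫⁻ x, Ψ x ∂(c • P.map Prod.fst) := lintegral_mono' hle le_rfl
    _ = c * ∫⁻ z, Ψ z.1 ∂P := by
        rw [lintegral_smul_measure, lintegral_map hΨ measurable_fst, smul_eq_mul]

/-- Tensorization by peeling off one pair. With the first pair frozen, the induction hypothesis
treats the others; what remains depends on the first pair only through `f 0` and its first
component. The weight `Φ` later serves to restrict to an event of the covariates. -/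
theorem lintegral_pi_fst_mul_prod_le (P : Measure (α × β)) [IsProbabilityMeasure P] (n : ℕ)
    (f : Fin n → α × β → ENNReal) (hf : ∀ i, Measurable (f i)) (c : Fin n → ENNReal)
    (hc : ∀ i A, MeasurableSet A →
      ∫⁻ z in Prod.fst ⁻¹' A, f i z ∂P ≤ c i * P (Prod.fst ⁻¹' A))
    (Φ : (Fin n → α) → ENNReal) (hΦ : Measurable Φ) :
    ∫⁻ z, (∏ i, f i (z i)) * Φ (fun i => (z i).1) ∂(Measure.pi fun _ => P) ≤
      (∏ i, c i) * ∫⁻ z, Φ (fun i => (z i).1) ∂(Measure.pi fun _ => P) := by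
  induction n with
  | zero => simp
  | succ n ih =>
    have mp := (measurePreserving_piFinSuccAbove (fun _ : Fin (n + 1) => P) 0).symm
    have hcons : Measurable fun q : (α × β) × (Fin n → α × β) =>
        (fun i => ((Fin.cons q.1 q.2 : Fin (n + 1) → α × β) i).1) := by
      refine measurable_pi_lambda _ fun i => ?_
      refine Fin.cases ?_ (fun j => ?_) i
      · exact measurable_fst.comp measurable_fst
      · exact measurable_fst.comp ((measurable_pi_apply j).comp measurable_snd)
    have hcons' : Measurable fun q : α × (Fin n → α × β) =>
        (Fin.cons q.1 (fun i => (q.2 i).1) : Fin (n + 1) → α) := by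
      refine measurable_pi_lambda _ fun i => ?_
      refine Fin.cases ?_ (fun j => ?_) i
      · simpa using measurable_fst
      · exact measurable_fst.comp ((measurable_pi_apply j).comp measurable_snd)
    have heq : ∀ (q : (α × β) × (Fin n → α × β)),
        (fun i => ((Fin.cons q.1 q.2 : Fin (n + 1) → α × β) i).1) =
          (Fin.cons q.1.1 (fun i => (q.2 i).1) : Fin (n + 1) → α) := by
      intro q
      funext i
      refine Fin.cases ?_ (fun j => ?_) i <;> simp
    have hprodm : Measurable fun z : Fin n → α × β => ∏ i, f i.succ (z i) :=
      Finset.measurable_prod _ fun i _ => (hf i.succ).comp (measurable_pi_apply i)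
    have hΦq : Measurable fun q : (α × β) × (Fin n → α × β) =>
        Φ (Fin.cons q.1.1 (fun i => (q.2 i).1)) := by
      simp only [← heq]; exact hΦ.comp hcons
    have hΨ : Measurable fun x : α =>
        ∫⁻ z, Φ (Fin.cons x (fun i => (z i).1)) ∂(Measure.pi fun _ : Fin n => P) :=
      Measurable.lintegral_prod_right (hΦ.comp hcons')
    rw [← mp.lintegral_comp_emb (MeasurableEquiv.measurableEmbedding _),
      ← mp.lintegral_comp_emb (MeasurableEquiv.measurableEmbedding _)]
    have hsymm : ∀ q, (MeasurableEquiv.piFinSuccAbove (fun _ : Fin (n + 1) => α × β) 0).symm q =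
        (Fin.cons q.1 q.2 : Fin (n + 1) → α × β) := by
      intro q
      funext i
      refine Fin.cases ?_ (fun j => ?_) i <;> rfl
    simp only [hsymm, Fin.prod_univ_succ, Fin.cons_zero, Fin.cons_succ, heq]
    have hint : Measurable fun q : (α × β) × (Fin n → α × β) =>
        (f 0 q.1 * ∏ i, f i.succ (q.2 i)) * Φ (Fin.cons q.1.1 (fun i => (q.2 i).1)) :=
      (((hf 0).comp measurable_fst).mul (hprodm.comp measurable_snd)).mul hΦq
    rw [lintegral_prod _ hΦq.aemeasurable, lintegral_prod _ hint.aemeasurable]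
    calc _ = ∫⁻ x, f 0 x * ∫⁻ z, (∏ i, f i.succ (z i)) * Φ (Fin.cons x.1 (fun i => (z i).1))
              ∂(Measure.pi fun _ : Fin n => P) ∂P := by
          refine lintegral_congr fun x => ?_
          simp only [mul_assoc]
          rw [lintegral_const_mul]
          exact hprodm.mul (hΦq.comp measurable_prodMk_left)
      _ ≤ ∫⁻ x, f 0 x * ((∏ i : Fin n, c i.succ) *
            ∫⁻ z, Φ (Fin.cons x.1 (fun i => (z i).1)) ∂(Measure.pi fun _ : Fin n => P)) ∂P := by
          refine lintegral_mono fun x => mul_le_mul_right ?_ _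
          refine ih (fun i => f i.succ) (fun i => hf i.succ) _ (fun i => hc i.succ)
            (fun y => Φ (Fin.cons x.1 y)) (hΦ.comp ?_)
          refine measurable_pi_lambda _ fun i => ?_
          refine Fin.cases ?_ (fun j => ?_) i
          · simp
          · simpa using measurable_pi_apply j
      _ ≤ c 0 * ∫⁻ x, ((∏ i : Fin n, c i.succ) *
            ∫⁻ z, Φ (Fin.cons x.1 (fun i => (z i).1)) ∂(Measure.pi fun _ : Fin n => P)) ∂P :=
          lintegral_fst_mul_le P (f 0) (hf 0) (c 0) (hc 0) _ (hΨ.const_mul _)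
      _ = _ := by
          rw [mul_assoc]
          exact congrArg _ (lintegral_const_mul _ (hΨ.comp measurable_fst))

end ProductBounds

/-! ### Sub-Gaussian tails for noise sums over indices selected by the covariates. -/

section NoiseTail

variable {α β : Type*} [MeasurableSpace α] [MeasurableSpace β]

theorem pi_measure_exp_tail_le (P : Measure (α × β)) [IsProbabilityMeasure P] {n : ℕ}
    {e : α × β → ℝ} (he : Measurable e) {v : ℝ}
    (hc : ∀ (t : ℝ) A, MeasurableSet A → ∫⁻ z in Prod.fst ⁻¹' A, ENNReal.ofReal
      (Real.exp (t * e z)) ∂P ≤ ENNReal.ofReal (Real.exp (v * t ^ 2 / 2)) * P (Prod.fst ⁻¹' A))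
    {B : Set (Fin n → α)} (hB : MeasurableSet B) (w : Finset (Fin n)) (t s : ℝ) :
    (Measure.pi fun _ => P) {z | (fun i => (z i).1) ∈ B ∧ s ≤ t * ∑ i ∈ w, e (z i)} ≤
      ENNReal.ofReal (Real.exp (w.card * (v * t ^ 2 / 2) - s)) *
        (Measure.pi fun _ => P) {z | (fun i => (z i).1) ∈ B} := by
  have hfst : Measurable fun z : Fin n → α × β => (fun i => (z i).1) :=
    measurable_pi_lambda _ fun i => measurable_fst.comp (measurable_pi_apply i)
  set f : Fin n → α × β → ENNReal :=
    fun i z => if i ∈ w then ENNReal.ofReal (Real.exp (t * e z)) else 1 with hf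
  set c : Fin n → ENNReal :=
    fun i => if i ∈ w then ENNReal.ofReal (Real.exp (v * t ^ 2 / 2)) else 1 with hcdef
  have hfm : ∀ i, Measurable (f i) := by
    intro i
    by_cases hi : i ∈ w
    · simp only [hf, hi, if_true]
      exact (Real.measurable_exp.comp (he.const_mul t)).ennreal_ofReal
    · simp only [hf, hi, if_false]
      exact measurable_const
  have hΦ : Measurable (B.indicator (1 : (Fin n → α) → ENNReal)) := measurable_one.indicator hB
  have key := lintegral_pi_fst_mul_prod_le P n f hfm c (fun i A hA => by
    by_cases hi : i ∈ w
    · simpa only [hf, hcdef, hi, if_true] using hc t A hA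
    · simp [hf, hcdef, hi]) (B.indicator 1) hΦ
  have hprodc : ∏ i, c i = ENNReal.ofReal (Real.exp (w.card * (v * t ^ 2 / 2))) := by
    simp only [hcdef, Finset.prod_ite_mem, Finset.univ_inter, Finset.prod_const]
    rw [← ENNReal.ofReal_pow (Real.exp_pos _).le, ← Real.exp_nat_mul]
  have hprodf : ∀ z : Fin n → α × β, ∏ i, f i (z i) =
      ENNReal.ofReal (Real.exp (t * ∑ i ∈ w, e (z i))) := by
    intro z
    simp only [hf, Finset.prod_ite_mem, Finset.univ_inter]
    rw [← ENNReal.ofReal_prod_of_nonneg fun i _ => (Real.exp_pos _).le, ← Real.exp_sum,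
      Finset.mul_sum]
  have hΦint : ∫⁻ z, B.indicator (1 : (Fin n → α) → ENNReal) (fun i => (z i).1)
      ∂(Measure.pi fun _ => P) = (Measure.pi fun _ => P) {z | (fun i => (z i).1) ∈ B} := by
    exact lintegral_indicator_one (hfst hB)
  rw [hprodc, hΦint] at key
  have hsub : {z : Fin n → α × β | (fun i => (z i).1) ∈ B ∧ s ≤ t * ∑ i ∈ w, e (z i)} ⊆
      {z | ENNReal.ofReal (Real.exp s) ≤
        (∏ i, f i (z i)) * B.indicator (1 : (Fin n → α) → ENNReal) (fun i => (z i).1)} := by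
    rintro z ⟨hz, hs⟩
    simp only [mem_ofPred_eq, hprodf, indicator_of_mem hz, Pi.one_apply, mul_one]
    exact ENNReal.ofReal_le_ofReal (Real.exp_le_exp.2 hs)
  have hmeas : Measurable fun z : Fin n → α × β =>
      (∏ i, f i (z i)) * B.indicator (1 : (Fin n → α) → ENNReal) (fun i => (z i).1) :=
    (Finset.measurable_prod _ fun i _ => (hfm i).comp (measurable_pi_apply i)).mul
      (hΦ.comp hfst)
  refine (measure_mono hsub).trans ((meas_ge_le_lintegral_div hmeas.aemeasurable
    (by simp [Real.exp_pos]) ENNReal.ofReal_ne_top).trans ?_)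
  refine (ENNReal.div_le_div_right key _).trans (le_of_eq ?_)
  rw [Real.exp_sub, ENNReal.ofReal_div_of_pos (Real.exp_pos _)]
  simp only [div_eq_mul_inv]
  rw [mul_right_comm]

theorem pi_measure_noise_tail_le (P : Measure (α × β)) [IsProbabilityMeasure P] {n : ℕ}
    {e : α × β → ℝ} (he : Measurable e) {v : ℝ} (hv : 0 ≤ v)
    (hc : ∀ (t : ℝ) A, MeasurableSet A → ∫⁻ z in Prod.fst ⁻¹' A, ENNReal.ofReal
      (Real.exp (t * e z)) ∂P ≤ ENNReal.ofReal (Real.exp (v * t ^ 2 / 2)) * P (Prod.fst ⁻¹' A))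
    {B : Set (Fin n → α)} (hB : MeasurableSet B) (w : Finset (Fin n)) {l : ℝ} (hl : 0 ≤ l) :
    (Measure.pi fun _ => P) {z | (fun i => (z i).1) ∈ B ∧
        √(2 * v * l * w.card) < |∑ i ∈ w, e (z i)|} ≤
      2 * ENNReal.ofReal (Real.exp (-l)) *
        (Measure.pi fun _ => P) {z | (fun i => (z i).1) ∈ B} := by
  rcases w.eq_empty_or_nonempty with rfl | hw
  · simp
  have hN : (0 : ℝ) < w.card := by exact_mod_cast hw.card_pos
  have tail := pi_measure_exp_tail_le P he hc hB w
  -- For `v = 0` the threshold is zero and no optimal `t` exists. The exponential bound then holds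
  -- for arbitrarily large `t`, which forces the sum to vanish almost surely on the event.
  rcases hv.eq_or_lt with rfl | hv
  · have hzero : (Measure.pi fun _ => P) {z : Fin n → α × β | (fun i => (z i).1) ∈ B ∧
        √(2 * 0 * l * w.card) < |∑ i ∈ w, e (z i)|} = 0 := by
      have hsub : {z : Fin n → α × β | (fun i => (z i).1) ∈ B ∧
          √(2 * 0 * l * w.card) < |∑ i ∈ w, e (z i)|} ⊆
          ⋃ p : ℕ × Bool, {z | (fun i => (z i).1) ∈ B ∧
            1 ≤ ((if p.2 then 1 else -1) * (p.1 : ℝ)) * ∑ i ∈ w, e (z i)} := by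
        rintro z ⟨hz, hs⟩
        have hs' : 0 < |∑ i ∈ w, e (z i)| := by simpa using hs
        obtain ⟨k, hk⟩ := exists_nat_gt (1 / |∑ i ∈ w, e (z i)|)
        have hk' : 1 ≤ (k : ℝ) * |∑ i ∈ w, e (z i)| := ((div_lt_iff₀ hs').1 hk).le
        rw [mem_iUnion]
        rcases abs_cases (∑ i ∈ w, e (z i)) with h | h
        · exact ⟨(k, true), hz, by rw [h.1] at hk'; simpa using hk'⟩
        · exact ⟨(k, false), hz, by rw [h.1] at hk'; simpa using hk'⟩
      refine measure_mono_null hsub (measure_iUnion_null fun p => ?_)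
      set a : ℝ := (if p.2 then 1 else -1) * (p.1 : ℝ)
      have hle : ∀ s : ℕ, (Measure.pi fun _ => P) {z : Fin n → α × β | (fun i => (z i).1) ∈ B ∧
          1 ≤ a * ∑ i ∈ w, e (z i)} ≤ ENNReal.ofReal (Real.exp (-s)) := by
        intro s
        refine (measure_mono ?_).trans ((tail (s * a) s).trans ?_)
        · rintro z ⟨hz, h1⟩
          refine ⟨hz, ?_⟩
          rw [mul_assoc]
          exact le_mul_of_one_le_right (Nat.cast_nonneg s) h1
        · refine (mul_le_of_le_one_right' prob_le_one).trans (le_of_eq ?_)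
          simp
      have hlim : Filter.Tendsto (fun s : ℕ => ENNReal.ofReal (Real.exp (-s))) Filter.atTop
          (nhds 0) := by
        have := ENNReal.tendsto_ofReal (Real.tendsto_exp_neg_atTop_nhds_zero.comp
          tendsto_natCast_atTop_atTop)
        simpa using this
      exact le_antisymm (ge_of_tendsto' hlim hle) zero_le
    rw [hzero]
    exact zero_le
  · set s := √(2 * v * l * w.card) with hs
    have hs2 : s ^ 2 = 2 * v * l * w.card := Real.sq_sqrt (by positivity)
    -- The minimizer of the Chernoff exponent `w.card * v * t ^ 2 / 2 - t * s`, whose value there is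
    -- `-l`.
    set t := s / (v * w.card) with ht
    have ht0 : 0 ≤ t := by positivity
    have hts : t * s = 2 * l := by
      rw [ht, div_mul_eq_mul_div, ← sq, hs2]; field_simp
    have hexp : (w.card : ℝ) * (v * t ^ 2 / 2) - 2 * l = -l := by
      have : t ^ 2 = 2 * l / (v * w.card) := by
        rw [ht, div_pow, hs2]; field_simp
      rw [this]; field_simp; ring
    have h1 := tail t (2 * l)
    have h2 := tail (-t) (2 * l)
    rw [neg_sq] at h2
    rw [hexp] at h1 h2
    refine (measure_mono ?_).trans ((measure_union_le _ _).trans ((add_le_add h1 h2).trans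
      (le_of_eq (by ring))))
    rintro z ⟨hz, hlt⟩
    rcases abs_cases (∑ i ∈ w, e (z i)) with h | h
    · left
      refine ⟨hz, ?_⟩
      rw [h.1] at hlt
      rw [← hts]
      exact mul_le_mul_of_nonneg_left hlt.le ht0
    · right
      refine ⟨hz, ?_⟩
      rw [h.1] at hlt
      rw [← hts, neg_mul, ← mul_neg]
      exact mul_le_mul_of_nonneg_left hlt.le ht0

/-- On each event `W = w` the index set is fixed. These events partition the space, so their
probabilities sum to one and the random choice costs no extra factor. -/
theorem pi_measure_selected_noise_tail_le (P : Measure (α × β)) [IsProbabilityMeasure P] {n : ℕ}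
    {e : α × β → ℝ} (he : Measurable e) {v : ℝ} (hv : 0 ≤ v)
    (hc : ∀ (t : ℝ) A, MeasurableSet A → ∫⁻ z in Prod.fst ⁻¹' A, ENNReal.ofReal
      (Real.exp (t * e z)) ∂P ≤ ENNReal.ofReal (Real.exp (v * t ^ 2 / 2)) * P (Prod.fst ⁻¹' A))
    (W : (Fin n → α) → Finset (Fin n)) (hW : ∀ w, MeasurableSet {x | W x = w})
    {l : ℝ} (hl : 0 ≤ l) :
    (Measure.pi fun _ => P) {z | √(2 * v * l * (W fun i => (z i).1).card) <
        |∑ i ∈ W fun i => (z i).1, e (z i)|} ≤ 2 * ENNReal.ofReal (Real.exp (-l)) := by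
  have hfst : Measurable fun z : Fin n → α × β => (fun i => (z i).1) :=
    measurable_pi_lambda _ fun i => measurable_fst.comp (measurable_pi_apply i)
  have hsum : ∑ w, (Measure.pi fun _ => P) {z : Fin n → α × β | (fun i => (z i).1) ∈
      {x | W x = w}} = 1 := by
    refine (measure_biUnion_finset (fun w _ w' _ hne => ?_) fun w _ => hfst (hW w)).symm.trans ?_
    swap
    · rw [← measure_univ (μ := Measure.pi fun _ : Fin n => P)]
      congr 1
      ext z
      simp
    · refine Set.disjoint_left.2 fun z hz hz' => hne ?_
      have h1 : W (fun i => (z i).1) = w := hz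
      exact h1.symm.trans hz'
  refine (measure_mono (t := ⋃ w, {z | (fun i => (z i).1) ∈ {x | W x = w} ∧
    √(2 * v * l * w.card) < |∑ i ∈ w, e (z i)|}) fun z hz => ?_).trans ?_
  · exact mem_iUnion.2 ⟨_, rfl, hz⟩
  · refine (measure_iUnion_fintype_le _ _).trans ?_
    refine (Finset.sum_le_sum fun w _ => pi_measure_noise_tail_le P he hv hc (hW w) w hl).trans ?_
    rw [← Finset.mul_sum, hsum, mul_one]

end NoiseTail

/-! ### Lower tail of a count, and approximation of boxes by a quantile grid. -/

theorem pi_measure_count_le {γ : Type*} [MeasurableSpace γ] (Q : Measure γ)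
    [IsProbabilityMeasure Q] (n : ℕ) {A : Set γ} (hA : MeasurableSet A) (s : ℝ) :
    (Measure.pi fun _ : Fin n => Q).real {z | ∑ i, A.indicator (fun _ => (1 : ℝ)) (z i) ≤ s} ≤
      Real.exp (s - n * Q.real A * (1 - Real.exp (-1))) := by
  have hint : Measurable (A.indicator fun _ => (1 : ℝ)) := measurable_const.indicator hA
  -- Chernoff's method with the fixed exponent `-1`, which is sharp enough for the constants needed.
  have hsingle : ∫ z, Real.exp (-A.indicator (fun _ => (1 : ℝ)) z) ∂Q =
      1 - Q.real A * (1 - Real.exp (-1)) := by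
    have : (fun z => Real.exp (-A.indicator (fun _ => (1 : ℝ)) z)) =
        fun z => 1 - A.indicator (fun _ => 1 - Real.exp (-1)) z := by
      funext z
      by_cases hz : z ∈ A <;> simp [hz]
    rw [this, integral_sub (integrable_const _) ((integrable_const _).indicator hA),
      integral_indicator_const _ hA]
    simp
  have hprod : ∫ z, Real.exp (-∑ i, A.indicator (fun _ => (1 : ℝ)) (z i))
      ∂(Measure.pi fun _ : Fin n => Q) = (1 - Q.real A * (1 - Real.exp (-1))) ^ n := by
    simp_rw [← Finset.sum_neg_distrib, Real.exp_sum]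
    rw [integral_fintype_prod_eq_prod (μ := fun _ : Fin n => Q)
      (f := fun _ z => Real.exp (-A.indicator (fun _ => (1 : ℝ)) z))]
    simp [hsingle]
  have hmarkov := mul_meas_ge_le_integral_of_nonneg (μ := Measure.pi fun _ : Fin n => Q)
    (f := fun z => Real.exp (-∑ i, A.indicator (fun _ => (1 : ℝ)) (z i)))
    (Filter.Eventually.of_forall fun z => (Real.exp_pos _).le)
    (by
      refine Integrable.of_bound (C := 1) ?_ (Filter.Eventually.of_forall fun z => ?_)
      · exact (Real.measurable_exp.comp (Finset.measurable_sum _ fun i _ =>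
          hint.comp (measurable_pi_apply i)).neg).aestronglyMeasurable
      · rw [Real.norm_eq_abs, abs_of_pos (Real.exp_pos _), Real.exp_le_one_iff, neg_nonpos]
        exact Finset.sum_nonneg fun i _ => indicator_nonneg (fun _ _ => zero_le_one) _)
    (Real.exp (-s))
  rw [hprod] at hmarkov
  simp only [Real.exp_le_exp, neg_le_neg_iff] at hmarkov
  have hpow : (1 - Q.real A * (1 - Real.exp (-1))) ^ n ≤
      Real.exp (-(n * Q.real A * (1 - Real.exp (-1)))) := by
    have h0 : 0 ≤ 1 - Q.real A * (1 - Real.exp (-1)) := by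
      rw [← hsingle]
      exact integral_nonneg fun z => (Real.exp_pos _).le
    have h1 : 1 - Q.real A * (1 - Real.exp (-1)) ≤
        Real.exp (-(Q.real A * (1 - Real.exp (-1)))) := Real.one_sub_le_exp_neg _
    calc _ ≤ _ := pow_le_pow_left₀ h0 h1 n
      _ = _ := by rw [← Real.exp_nat_mul]; ring_nf
  have := hmarkov.trans hpow
  rw [Real.exp_neg, inv_mul_le_iff₀ (Real.exp_pos _), ← Real.exp_add] at this
  simpa [sub_eq_add_neg] using this

section Grid

theorem continuous_cdf_of_noAtoms (ρ : Measure ℝ) [IsProbabilityMeasure ρ] [NullSingletonClass ρ] :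
    Continuous (cdf ρ) := by
  rw [continuous_iff_continuousAt]
  intro a
  refine continuousAt_iff_continuous_left'_right'.2 ⟨?_, ?_⟩
  · rw [(cdf ρ).mono.continuousWithinAt_Iio_iff_leftLim_eq]
    have h := (cdf ρ).measure_singleton a
    rw [measure_cdf, measure_singleton, eq_comm, ENNReal.ofReal_eq_zero] at h
    exact le_antisymm ((cdf ρ).mono.leftLim_le le_rfl) (by linarith)
  · exact ((cdf ρ).right_continuous a).mono Ioi_subset_Ici_self

theorem exists_quantiles (ρ : Measure ℝ) [IsProbabilityMeasure ρ] [NullSingletonClass ρ]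
    (hρ : ρ (Icc 0 1) = 1) {N : ℕ} (hN : 0 < N) :
    ∃ q : ℕ → ℝ, ∀ j ≤ N, cdf ρ (q j) = j / N := by
  have h0 : cdf ρ (-1) = 0 := by
    have hdis : ρ (Icc 0 1)ᶜ = 0 := by rw [prob_compl_eq_zero_iff measurableSet_Icc]; exact hρ
    have hsub : Iic (-1 : ℝ) ⊆ (Icc 0 1)ᶜ := fun x hx hx' => by
      linarith [hx'.1, mem_Iic.1 hx]
    have hz : ρ (Iic (-1)) = 0 := measure_mono_null hsub hdis
    rw [cdf_eq_real, measureReal_def, hz, ENNReal.toReal_zero]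
  have h1 : cdf ρ 1 = 1 := by
    have : ρ (Iic 1) = 1 := le_antisymm prob_le_one (hρ ▸ measure_mono Icc_subset_Iic_self)
    rw [cdf_eq_real, measureReal_def, this, ENNReal.toReal_one]
  have key : ∀ j : ℕ, ∃ x, j ≤ N → cdf ρ x = j / N := by
    intro j
    by_cases hj : j ≤ N
    · obtain ⟨x, hx⟩ := mem_range_of_exists_le_of_exists_ge (continuous_cdf_of_noAtoms ρ)
        (c := (j : ℝ) / N) ⟨-1, by rw [h0]; positivity⟩
        ⟨1, by rw [h1]; exact div_le_one_of_le₀ (by exact_mod_cast hj) (by positivity)⟩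
      exact ⟨x, fun _ => hx⟩
    · exact ⟨0, fun h => absurd h hj⟩
  choose q hq using key
  exact ⟨q, hq⟩

theorem measureReal_Ioc_eq_cdf_sub (ρ : Measure ℝ) [IsProbabilityMeasure ρ] {a b : ℝ}
    (hab : a ≤ b) : ρ.real (Ioc a b) = cdf ρ b - cdf ρ a := by
  have := measureReal_sdiff (μ := ρ) (Iic_subset_Iic.2 hab) measurableSet_Iic
  rw [Iic_sdiff_Iic] at this
  rw [this, cdf_eq_real, cdf_eq_real]

/-- The indices are the first grid level strictly above `cdf ρ lo` and the last strictly below `cdf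
ρ hi`. Strictness lets monotonicity order the points even where the cdf is flat; positive mass keeps
both indices in range. The grid interval itself may be empty. -/
theorem exists_grid_interval (ρ : Measure ℝ) [IsProbabilityMeasure ρ] {N : ℕ} (hN : 0 < N)
    {q : ℕ → ℝ} (hq : ∀ j ≤ N, cdf ρ (q j) = j / N) {lo hi : ℝ} (h : 0 < ρ.real (Ioc lo hi)) :
    ∃ i ≤ N, ∃ j ≤ N, lo ≤ q i ∧ q j ≤ hi ∧
      ρ.real (Ioc lo (q i)) ≤ 1 / N ∧ ρ.real (Ioc (q j) hi) ≤ 1 / N := by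
  have hN' : (0 : ℝ) < N := by exact_mod_cast hN
  have hlt : lo ≤ hi := by
    by_contra hcon
    rw [Ioc_eq_empty (fun h' => hcon h'.le)] at h
    simp at h
  rw [measureReal_Ioc_eq_cdf_sub ρ hlt] at h
  have hlo0 := cdf_nonneg ρ lo
  have hlo1 : cdf ρ lo < 1 := by linarith [cdf_le_one ρ hi]
  have hhi0 : 0 < cdf ρ hi := by linarith
  have hhi1 := cdf_le_one ρ hi
  have hi1 : ⌊N * cdf ρ lo⌋₊ + 1 ≤ N := by
    rw [Nat.succ_le_iff, Nat.floor_lt (by positivity)]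
    nlinarith
  have hf1 := Nat.lt_floor_add_one (N * cdf ρ lo)
  have hf2 := Nat.floor_le (a := N * cdf ρ lo) (by positivity)
  have hc0 : 0 < ⌈N * cdf ρ hi⌉₊ := Nat.ceil_pos.2 (by positivity)
  have hj1 : ⌈N * cdf ρ hi⌉₊ ≤ N := Nat.ceil_le.2 (by nlinarith)
  obtain ⟨c, hc⟩ : ∃ c, ⌈N * cdf ρ hi⌉₊ = c + 1 := Nat.exists_eq_succ_of_ne_zero hc0.ne'
  have hf3 := Nat.le_ceil (N * cdf ρ hi)
  have hf4 := Nat.ceil_lt_add_one (a := N * cdf ρ hi) (by positivity)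
  rw [hc] at hf3 hf4 hj1
  push_cast at hf3 hf4
  have hqi := hq _ hi1
  have hqj := hq c (by omega)
  push_cast at hqi
  have hloqi : lo ≤ q (⌊N * cdf ρ lo⌋₊ + 1) := by
    refine ((cdf ρ).mono.reflect_lt ?_).le
    rw [hqi, lt_div_iff₀ hN']; linarith
  have hqjhi : q c ≤ hi := by
    refine ((cdf ρ).mono.reflect_lt ?_).le
    rw [hqj, div_lt_iff₀ hN']; linarith
  refine ⟨_, hi1, c, by omega, hloqi, hqjhi, ?_, ?_⟩
  · rw [measureReal_Ioc_eq_cdf_sub ρ hloqi, hqi, le_div_iff₀ hN', sub_mul,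
      div_mul_cancel₀ _ hN'.ne']
    linarith
  · rw [measureReal_Ioc_eq_cdf_sub ρ hqjhi, hqj, le_div_iff₀ hN', sub_mul,
      div_mul_cancel₀ _ hN'.ne']
    linarith

/-- The half-open box `∏ (lo k, hi k]`. -/
def halfOpenBox {d : ℕ} (lo hi : Fin d → ℝ) : Set (EuclideanSpace ℝ (Fin d)) :=
  {x | ∀ k, x k ∈ Ioc (lo k) (hi k)}

theorem measurable_euclidean_apply {d : ℕ} (k : Fin d) :
    Measurable fun x : EuclideanSpace ℝ (Fin d) => x k := by fun_prop

theorem measurableSet_halfOpenBox {d : ℕ} (lo hi : Fin d → ℝ) :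
    MeasurableSet (halfOpenBox lo hi) := by
  have : halfOpenBox lo hi = ⋂ k, (fun x : EuclideanSpace ℝ (Fin d) => x k) ⁻¹'
      Ioc (lo k) (hi k) := by
    ext x; simp [halfOpenBox]
  rw [this]
  exact MeasurableSet.iInter fun k => measurable_euclidean_apply k measurableSet_Ioc

theorem exists_grid_box {d : ℕ} (ν : Measure (EuclideanSpace ℝ (Fin d))) [IsProbabilityMeasure ν]
    (hatom : ∀ (k : Fin d) (a : ℝ), ν {x | x k = a} = 0) (hcube : ν (unitCube d) = 1)
    {N : ℕ} (hN : 0 < N) :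
    ∃ A : (Fin d → Fin (N + 1) × Fin (N + 1)) → Set (EuclideanSpace ℝ (Fin d)),
      (∀ ι, MeasurableSet (A ι)) ∧ ∀ lo hi, 0 < ν.real (halfOpenBox lo hi) →
        ∃ ι, A ι ⊆ halfOpenBox lo hi ∧ ν.real (halfOpenBox lo hi) ≤ ν.real (A ι) + 2 * d / N := by
  have hp : ∀ k, IsProbabilityMeasure (ν.map fun x => x k) := fun k =>
    Measure.isProbabilityMeasure_map (measurable_euclidean_apply k).aemeasurable
  have hna : ∀ k, NullSingletonClass (ν.map fun x => x k) := fun k => ⟨fun a => by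
    rw [Measure.map_apply (measurable_euclidean_apply k) (measurableSet_singleton a)]
    exact hatom k a⟩
  have hreal : ∀ k (S : Set ℝ), MeasurableSet S →
      (ν.map fun x => x k).real S = ν.real {x | x k ∈ S} := fun k S hS =>
    map_measureReal_apply (measurable_euclidean_apply k) hS
  have hq : ∀ k : Fin d, ∃ q : ℕ → ℝ, ∀ j ≤ N, cdf (ν.map fun x => x k) (q j) = j / N := by
    intro k
    refine exists_quantiles _ ?_ hN
    rw [Measure.map_apply (measurable_euclidean_apply k) measurableSet_Icc]
    exact le_antisymm prob_le_one (hcube ▸ measure_mono fun x hx => hx k)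
  choose q hq using hq
  refine ⟨fun ι => halfOpenBox (fun k => q k (ι k).1) (fun k => q k (ι k).2),
    fun ι => measurableSet_halfOpenBox _ _, fun lo hi hpos => ?_⟩
  have hk : ∀ k : Fin d, ∃ i : Fin (N + 1) × Fin (N + 1), lo k ≤ q k i.1 ∧ q k i.2 ≤ hi k ∧
      ν.real {x | x k ∈ Ioc (lo k) (q k i.1)} ≤ 1 / N ∧
      ν.real {x | x k ∈ Ioc (q k i.2) (hi k)} ≤ 1 / N := by
    intro k
    obtain ⟨i, hi', j, hj, h1, h2, h3, h4⟩ := exists_grid_interval (ν.map fun x => x k) hN (hq k)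
      (lo := lo k) (hi := hi k) (by
        rw [hreal k _ measurableSet_Ioc]
        exact hpos.trans_le (measureReal_mono fun x hx => hx k))
    refine ⟨(⟨i, by omega⟩, ⟨j, by omega⟩), h1, h2, ?_, ?_⟩
    · rwa [hreal k _ measurableSet_Ioc] at h3
    · rwa [hreal k _ measurableSet_Ioc] at h4
  choose ι h1 h2 h3 h4 using hk
  refine ⟨ι, fun x hx k => ⟨(h1 k).trans_lt (hx k).1, (hx k).2.trans (h2 k)⟩, ?_⟩
  -- What the grid box misses lies in `2 * d` slabs, each of mass at most `1 / N`.
  have hcover : halfOpenBox lo hi ⊆ halfOpenBox (fun k => q k (ι k).1) (fun k => q k (ι k).2) ∪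
      ⋃ k, ({x | x k ∈ Ioc (lo k) (q k (ι k).1)} ∪ {x | x k ∈ Ioc (q k (ι k).2) (hi k)}) := by
    intro x hx
    by_cases hin : ∀ k, x k ∈ Ioc (q k (ι k).1) (q k (ι k).2)
    · exact Or.inl hin
    · right
      push Not at hin
      obtain ⟨k, hk⟩ := hin
      refine mem_iUnion.2 ⟨k, ?_⟩
      rcases le_or_gt (x k) (q k (ι k).1) with h | h
      · exact Or.inl ⟨(hx k).1, h⟩
      · exact Or.inr ⟨not_le.1 fun h' => hk ⟨h, h'⟩, (hx k).2⟩
  refine (measureReal_mono hcover).trans ((measureReal_union_le _ _).trans ?_)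
  gcongr
  refine (measureReal_iUnion_fintype_le _).trans ?_
  refine (Finset.sum_le_sum fun k _ => (measureReal_union_le _ _).trans
    (add_le_add (h3 k) (h4 k))).trans (le_of_eq ?_)
  simp only [Finset.sum_const, Finset.card_univ, Fintype.card_fin, nsmul_eq_mul]
  ring

end Grid

/-! ### Boxes with few sample points have small mass. -/

theorem dim_le_of_log_le {d n m : ℕ} {δ : ℝ} (hδ : 0 < δ) (hδ1 : δ < 1 / 3) (hn : 1 ≤ n)
    (hm : 4 * Real.log (4 * (2 * (n : ℝ) + 1) ^ (2 * d) / δ) ≤ m) : 8 * (d : ℝ) ≤ m := by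
  have hn' : (1 : ℝ) ≤ n := by exact_mod_cast hn
  have h1 : 1 ≤ Real.log (2 * (n : ℝ) + 1) := by
    rw [Real.le_log_iff_exp_le (by positivity)]
    linarith [Real.exp_one_lt_d9]
  have h2 : Real.log ((2 * (n : ℝ) + 1) ^ (2 * d)) ≤
      Real.log (4 * (2 * (n : ℝ) + 1) ^ (2 * d) / δ) := by
    refine Real.log_le_log (by positivity) ?_
    rw [le_div_iff₀ hδ]
    have : 0 < (2 * (n : ℝ) + 1) ^ (2 * d) := by positivity
    nlinarith
  rw [Real.log_pow] at h2
  push_cast at h2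
  nlinarith [Nat.cast_nonneg (α := ℝ) d]

theorem pi_measure_light_box_heavy_mass_le {d n m : ℕ}
    (P : Measure (EuclideanSpace ℝ (Fin d) × ℝ)) [IsProbabilityMeasure P]
    (hatom : ∀ (k : Fin d) (a : ℝ), P.map Prod.fst {x | x k = a} = 0)
    (hcube : P.map Prod.fst (unitCube d) = 1) {δ : ℝ} (hδ : 0 < δ) (hδ1 : δ < 1 / 3)
    (hn : 1 ≤ n) (hm : 4 * Real.log (4 * (2 * (n : ℝ) + 1) ^ (2 * d) / δ) ≤ m) :
    (Measure.pi fun _ : Fin n => P) {z | ∃ lo hi : Fin d → ℝ,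
      empCount (fun i => (z i).1) (halfOpenBox lo hi) ≤ 2 * m ∧
        5 * m / n < (P.map Prod.fst).real (halfOpenBox lo hi)} ≤ ENNReal.ofReal δ := by
  have hn' : (0 : ℝ) < n := by exact_mod_cast hn
  set ν := P.map Prod.fst with hν
  have : IsProbabilityMeasure ν := Measure.isProbabilityMeasure_map measurable_fst.aemeasurable
  obtain ⟨A, hA, hgrid⟩ := exists_grid_box ν hatom hcube (N := 2 * n) (by omega)
  have hdm := dim_le_of_log_le hδ hδ1 hn hm
  -- With `N = 2 * n` the grid loses mass at most `d / n`, and `8 * d ≤ m` turns `5 * m - d` into at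
  -- least `39 / 8 * m`.
  set S : (Fin d → Fin (2 * n + 1) × Fin (2 * n + 1)) →
      Set (Fin n → EuclideanSpace ℝ (Fin d) × ℝ) := fun ι =>
    {z | 39 / 8 * (m : ℝ) ≤ n * ν.real (A ι) ∧
      ∑ i, (Prod.fst ⁻¹' A ι).indicator (fun _ => (1 : ℝ)) (z i) ≤ 2 * m} with hS
  have hcover : {z : Fin n → EuclideanSpace ℝ (Fin d) × ℝ | ∃ lo hi : Fin d → ℝ,
      empCount (fun i => (z i).1) (halfOpenBox lo hi) ≤ 2 * m ∧
        5 * m / n < ν.real (halfOpenBox lo hi)} ⊆ ⋃ ι, S ι := by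
    rintro z ⟨lo, hi, hcount, hmass⟩
    obtain ⟨ι, hsub, hle⟩ := hgrid lo hi ((by positivity : (0 : ℝ) ≤ 5 * m / n).trans_lt hmass)
    refine mem_iUnion.2 ⟨ι, ?_, ?_⟩
    · have h1 : 5 * (m : ℝ) / n < ν.real (A ι) + d / n := by
        refine hmass.trans_le (hle.trans (le_of_eq ?_))
        push_cast
        rw [mul_div_mul_left _ _ two_ne_zero]
      rw [div_lt_iff₀ hn', add_mul, div_mul_cancel₀ _ hn'.ne'] at h1
      linarith
    · refine le_trans (Finset.sum_le_sum fun i _ => ?_) hcount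
      exact indicator_le_indicator_of_subset hsub (fun _ => zero_le_one) (z i).1
  have hSle : ∀ ι, (Measure.pi fun _ : Fin n => P) (S ι) ≤ ENNReal.ofReal (Real.exp (-(m / 4))) := by
    intro ι
    by_cases hι : 39 / 8 * (m : ℝ) ≤ n * ν.real (A ι)
    · have hchernoff := pi_measure_count_le P n (measurable_fst (hA ι)) (2 * (m : ℝ))
      have heq : P.real (Prod.fst ⁻¹' A ι) = ν.real (A ι) :=
        (map_measureReal_apply measurable_fst (hA ι)).symm
      rw [heq] at hchernoff
      -- Since `1 - exp (-1) > 1 / 2`, the exponent is at most `2 * m - 39 / 16 * m`, which is below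
      -- `-m / 4`.
      have hexp : Real.exp (2 * (m : ℝ) - n * ν.real (A ι) * (1 - Real.exp (-1))) ≤
          Real.exp (-(m / 4)) := by
        refine Real.exp_le_exp.2 ?_
        have := Real.exp_neg_one_lt_half
        have hm0 : (0 : ℝ) ≤ m := Nat.cast_nonneg m
        nlinarith
      have hsub : S ι ⊆ {z | ∑ i, (Prod.fst ⁻¹' A ι).indicator (fun _ => (1 : ℝ)) (z i) ≤
          2 * m} := fun z hz => hz.2
      refine (measure_mono hsub).trans ?_
      rw [← ofReal_measureReal]
      exact ENNReal.ofReal_le_ofReal (hchernoff.trans hexp)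
    · have : S ι = ∅ := by
        ext z; simp [hS, hι]
      rw [this, measure_empty]
      exact zero_le
  refine (measure_mono hcover).trans ((measure_iUnion_fintype_le _ _).trans
    ((Finset.sum_le_sum fun ι _ => hSle ι).trans ?_))
  rw [Finset.sum_const, Finset.card_univ, nsmul_eq_mul, ← ENNReal.ofReal_natCast,
    ← ENNReal.ofReal_mul (Nat.cast_nonneg _)]
  refine ENNReal.ofReal_le_ofReal ?_
  have hcard : ((Fintype.card (Fin d → Fin (2 * n + 1) × Fin (2 * n + 1)) : ℕ) : ℝ) =
      (2 * (n : ℝ) + 1) ^ (2 * d) := by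
    simp [pow_mul, sq]
  rw [hcard]
  have hexp : Real.exp (-(m / 4)) ≤ (4 * (2 * (n : ℝ) + 1) ^ (2 * d) / δ)⁻¹ := by
    rw [← Real.exp_log (show (0 : ℝ) < 4 * (2 * (n : ℝ) + 1) ^ (2 * d) / δ by positivity),
      ← Real.exp_neg]
    exact Real.exp_le_exp.2 (by linarith)
  have hpos : (0 : ℝ) < (2 * (n : ℝ) + 1) ^ (2 * d) := by positivity
  calc _ ≤ (2 * (n : ℝ) + 1) ^ (2 * d) * (4 * (2 * (n : ℝ) + 1) ^ (2 * d) / δ)⁻¹ :=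
        mul_le_mul_of_nonneg_left hexp hpos.le
    _ = δ / 4 := by field_simp
    _ ≤ δ := by linarith

/-! ### Consequences of the density and noise assumptions. -/

theorem volume_coordinate_eq_zero {d : ℕ} (k : Fin d) (a : ℝ) :
    volume {x : EuclideanSpace ℝ (Fin d) | x k = a} = 0 := by
  have h := (EuclideanSpace.volume_preserving_symm_measurableEquiv_toLp (Fin d)).measure_preimage
    (s := {y : Fin d → ℝ | y k = a})
    (measurableSet_eq_fun (measurable_pi_apply k) measurable_const).nullMeasurableSet
  have h2 : volume {y : Fin d → ℝ | y k = a} = 0 := by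
    rw [volume_pi]; exact Measure.pi_hyperplane (fun _ : Fin d => (volume : Measure ℝ)) k a
  rw [h2] at h
  exact h

theorem volume_halfOpenBox {d : ℕ} (lo hi : Fin d → ℝ) :
    volume (halfOpenBox lo hi) = ∏ k, ENNReal.ofReal (hi k - lo k) := by
  have h := (EuclideanSpace.volume_preserving_symm_measurableEquiv_toLp (Fin d)).measure_preimage
    (s := Set.pi univ fun k => Ioc (lo k) (hi k))
    (MeasurableSet.univ_pi fun k => measurableSet_Ioc).nullMeasurableSet
  rw [Real.volume_pi_Ioc] at h
  rw [← h]
  congr 1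
  ext x
  simp [halfOpenBox]

theorem measurableSet_unitCube (d : ℕ) : MeasurableSet (unitCube d) := by
  have : unitCube d = ⋂ k, (fun x : EuclideanSpace ℝ (Fin d) => x k) ⁻¹' Icc 0 1 := by
    ext x; simp [unitCube]
  rw [this]
  exact MeasurableSet.iInter fun k => measurable_euclidean_apply k measurableSet_Icc

section Model

variable {d : ℕ} {P : Measure (EuclideanSpace ℝ (Fin d) × ℝ)} {b : ℝ}

theorem DensityBoundedBelow.coordinate_null (h : DensityBoundedBelow P b) (k : Fin d) (a : ℝ) :
    P.map Prod.fst {x | x k = a} = 0 := by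
  obtain ⟨f, -, hP, -⟩ := h
  rw [hP]
  exact withDensity_absolutelyContinuous _ _ (Measure.restrict_le_self.absolutelyContinuous
    (volume_coordinate_eq_zero k a))

variable [IsProbabilityMeasure P]

theorem DensityBoundedBelow.map_unitCube (h : DensityBoundedBelow P b) :
    P.map Prod.fst (unitCube d) = 1 := by
  have : IsProbabilityMeasure (P.map Prod.fst) :=
    Measure.isProbabilityMeasure_map measurable_fst.aemeasurable
  obtain ⟨f, -, hP, -⟩ := h
  have hc : P.map Prod.fst (unitCube d)ᶜ = 0 := by
    rw [hP]
    refine withDensity_absolutelyContinuous _ _ ?_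
    rw [Measure.restrict_apply (measurableSet_unitCube d).compl]
    simp
  exact (prob_compl_eq_zero_iff (measurableSet_unitCube d)).1 hc

theorem DensityBoundedBelow.le_measureReal_box (h : DensityBoundedBelow P b) (hb : 0 ≤ b)
    {lo hi : Fin d → ℝ} (hle : lo ≤ hi) (hsub : halfOpenBox lo hi ⊆ unitCube d) :
    b * ∏ k, (hi k - lo k) ≤ (P.map Prod.fst).real (halfOpenBox lo hi) := by
  have : IsProbabilityMeasure (P.map Prod.fst) :=
    Measure.isProbabilityMeasure_map measurable_fst.aemeasurable
  obtain ⟨f, -, hP, hf⟩ := h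
  have hprod : 0 ≤ ∏ k, (hi k - lo k) :=
    Finset.prod_nonneg fun k _ => sub_nonneg.2 (hle k)
  have key : ENNReal.ofReal (b * ∏ k, (hi k - lo k)) ≤ P.map Prod.fst (halfOpenBox lo hi) := by
    have hm := measurableSet_halfOpenBox lo hi
    rw [hP, withDensity_apply _ hm, Measure.restrict_restrict hm, inter_eq_left.2 hsub,
      ENNReal.ofReal_mul hb, ENNReal.ofReal_prod_of_nonneg fun k _ => sub_nonneg.2 (hle k),
      ← volume_halfOpenBox, ← setLIntegral_const]
    exact setLIntegral_mono' hm fun x hx => hf x (hsub hx)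
  rw [measureReal_def, ← ENNReal.toReal_ofReal (mul_nonneg hb hprod)]
  exact ENNReal.toReal_mono (measure_ne_top _ _) key

/-- Integrates the conditional bound over events of `X`, the form used by the product bounds.
Passing to `g'` allows a measurable version of `g`, which is arbitrary off the cube. -/
theorem CondSubGaussianNoise.setLIntegral_exp_le {g g' : EuclideanSpace ℝ (Fin d) → ℝ} {σ : ℝ}
    (h : CondSubGaussianNoise P g σ) (hgg' : (fun z => g z.1) =ᵐ[P] fun z => g' z.1) (t : ℝ)
    (A : Set (EuclideanSpace ℝ (Fin d))) (hA : MeasurableSet A) :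
    ∫⁻ z in Prod.fst ⁻¹' A, ENNReal.ofReal (Real.exp (t * (z.2 - g' z.1))) ∂P ≤
      ENNReal.ofReal (Real.exp (σ ^ 2 * t ^ 2 / 2)) * P (Prod.fst ⁻¹' A) := by
  obtain ⟨-, -, h⟩ := h
  obtain ⟨hint, hcond⟩ := h t
  have hle : MeasurableSpace.comap (Prod.fst : EuclideanSpace ℝ (Fin d) × ℝ → _) inferInstance ≤
      (inferInstance : MeasurableSpace (EuclideanSpace ℝ (Fin d) × ℝ)) :=
    measurable_fst.comap_le
  have hset := setIntegral_condExp hle hint (s := Prod.fst ⁻¹' A) ⟨A, hA, rfl⟩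
  calc ∫⁻ z in Prod.fst ⁻¹' A, ENNReal.ofReal (Real.exp (t * (z.2 - g' z.1))) ∂P
      = ∫⁻ z in Prod.fst ⁻¹' A, ENNReal.ofReal (Real.exp (t * (z.2 - g z.1))) ∂P := by
        refine lintegral_congr_ae (ae_restrict_of_ae ?_)
        filter_upwards [hgg'] with z hz
        rw [hz]
    _ = ENNReal.ofReal (∫ z in Prod.fst ⁻¹' A, Real.exp (t * (z.2 - g z.1)) ∂P) :=
        (ofReal_integral_eq_lintegral_ofReal hint.integrableOn
          (Filter.Eventually.of_forall fun z => (Real.exp_pos _).le)).symm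
    _ ≤ ENNReal.ofReal (Real.exp (σ ^ 2 * t ^ 2 / 2) * P.real (Prod.fst ⁻¹' A)) := by
        rw [← hset]
        refine ENNReal.ofReal_le_ofReal ?_
        calc _ ≤ ∫ z in Prod.fst ⁻¹' A, Real.exp (σ ^ 2 * t ^ 2 / 2) ∂P :=
              integral_mono_ae integrable_condExp.integrableOn (integrable_const _)
                (ae_restrict_of_ae hcond)
          _ = _ := by simp [mul_comm]
    _ = _ := by
        rw [ENNReal.ofReal_mul (Real.exp_pos _).le, ofReal_measureReal]

theorem ae_pi_fst_mem_unitCube (h : DensityBoundedBelow P b) (n : ℕ) :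
    ∀ᵐ z ∂(Measure.pi fun _ : Fin n => P), ∀ i, (z i).1 ∈ unitCube d := by
  refine ae_all_iff.2 fun i => ?_
  have : ∀ᵐ p ∂P, p.1 ∈ unitCube d := by
    have hP : IsProbabilityMeasure (P.map Prod.fst) :=
      Measure.isProbabilityMeasure_map measurable_fst.aemeasurable
    refine ae_of_ae_map measurable_fst.aemeasurable (p := fun x => x ∈ unitCube d) ?_
    exact (mem_ae_iff_prob_eq_one (measurableSet_unitCube d)).2 h.map_unitCube
  exact (Measure.quasiMeasurePreserving_eval (μ := fun _ : Fin n => P) i).ae this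

theorem ae_pi_fst_ne (h : DensityBoundedBelow P b) (n : ℕ) (a : ℝ) :
    ∀ᵐ z ∂(Measure.pi fun _ : Fin n => P), ∀ i k, (z i).1 k ≠ a := by
  refine ae_all_iff.2 fun i => ae_all_iff.2 fun k => ?_
  have : ∀ᵐ p ∂P, p.1 k ≠ a := by
    refine ae_of_ae_map measurable_fst.aemeasurable
      (p := fun x : EuclideanSpace ℝ (Fin d) => x k ≠ a) ?_
    rw [ae_iff]
    simpa using h.coordinate_null k a
  exact (Measure.quasiMeasurePreserving_eval (μ := fun _ : Fin n => P) i).ae this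

theorem ae_pi_fst_injective (h : DensityBoundedBelow P b) (n : ℕ) :
    ∀ᵐ z ∂(Measure.pi fun _ : Fin n => P), ∀ k, Function.Injective fun i => (z i).1 k := by
  have key : ∀ k (i j : Fin n), i ≠ j →
      ∀ᵐ z ∂(Measure.pi fun _ : Fin n => P), (z i).1 k ≠ (z j).1 k := by
    intro k i j hij
    have hindep := (iIndepFun_pi (μ := fun _ : Fin n => P) (X := fun _ z => z)
      fun _ => measurable_id.aemeasurable).indepFun hij
    have hmap := (indepFun_iff_map_prod_eq_prod_map_map
      (measurable_pi_apply i).aemeasurable (measurable_pi_apply j).aemeasurable).1 hindep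
    rw [(measurePreserving_eval (fun _ : Fin n => P) i).map_eq,
      (measurePreserving_eval (fun _ : Fin n => P) j).map_eq] at hmap
    refine ae_of_ae_map (f := fun z : Fin n → _ => (z i, z j))
      (p := fun q : (EuclideanSpace ℝ (Fin d) × ℝ) × (EuclideanSpace ℝ (Fin d) × ℝ) =>
        q.1.1 k ≠ q.2.1 k)
      ((measurable_pi_apply i).prodMk (measurable_pi_apply j)).aemeasurable ?_
    rw [hmap, ae_iff]
    have hms : MeasurableSet {q : (EuclideanSpace ℝ (Fin d) × ℝ) × (EuclideanSpace ℝ (Fin d) × ℝ) |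
        ¬ q.1.1 k ≠ q.2.1 k} := by
      simp only [not_not]
      exact measurableSet_eq_fun
        ((measurable_euclidean_apply k).comp (measurable_fst.comp measurable_fst))
        ((measurable_euclidean_apply k).comp (measurable_fst.comp measurable_snd))
    rw [Measure.measure_prod_null hms]
    refine Filter.Eventually.of_forall fun p => ?_
    have := h.coordinate_null k (p.1 k)
    rw [Measure.map_apply measurable_fst
      (measurableSet_eq_fun (measurable_euclidean_apply k) measurable_const)] at this
    refine measure_mono_null (fun q hq => ?_) this
    simpa [eq_comm] using hq
  have hall : ∀ᵐ z ∂(Measure.pi fun _ : Fin n => P), ∀ k (i j : Fin n), i ≠ j →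
      (z i).1 k ≠ (z j).1 k :=
    ae_all_iff.2 fun k => ae_all_iff.2 fun i => ae_all_iff.2 fun j => ae_all_iff.2 fun hij =>
      key k i j hij
  filter_upwards [hall] with z hz k i j hij
  by_contra hne
  exact hz k i j hne hij

end Model

/-! ### Coordinate ranks: finitely many measurable rules describe all cells. -/

section Ranks

variable {d n : ℕ}

/-- The number of points whose `k`-th coordinate is at most that of the `i`-th point. -/
noncomputable def coordRank (x : Fin n → EuclideanSpace ℝ (Fin d)) (k : Fin d) (i : Fin n) : ℕ :=
  ∑ j, if x j k ≤ x i k then 1 else 0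

/-- The indices of the points whose coordinate ranks lie in prescribed intervals. -/
noncomputable def rankSelect (c : Fin d → Fin (n + 1) × Fin (n + 1))
    (x : Fin n → EuclideanSpace ℝ (Fin d)) : Finset (Fin n) :=
  open Classical in Finset.univ.filter fun i =>
    ∀ k, ((c k).1 : ℕ) < coordRank x k i ∧ coordRank x k i ≤ (c k).2

theorem mem_rankSelect (c : Fin d → Fin (n + 1) × Fin (n + 1))
    (x : Fin n → EuclideanSpace ℝ (Fin d)) (i : Fin n) :
    i ∈ rankSelect c x ↔ ∀ k, ((c k).1 : ℕ) < coordRank x k i ∧ coordRank x k i ≤ (c k).2 := by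
  simp [rankSelect]

theorem measurable_coordRank (k : Fin d) (i : Fin n) :
    Measurable fun x : Fin n → EuclideanSpace ℝ (Fin d) => coordRank x k i := by
  refine Finset.measurable_sum _ fun j _ => ?_
  refine Measurable.ite (measurableSet_le ?_ ?_) measurable_const measurable_const
  · exact (measurable_euclidean_apply k).comp (measurable_pi_apply j)
  · exact (measurable_euclidean_apply k).comp (measurable_pi_apply i)

theorem measurableSet_rankSelect_eq (c : Fin d → Fin (n + 1) × Fin (n + 1))
    (w : Finset (Fin n)) : MeasurableSet {x | rankSelect c x = w} := by
  have : {x | rankSelect c x = w} = {x | ∀ i, (i ∈ w ↔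
      ∀ k, ((c k).1 : ℕ) < coordRank x k i ∧ coordRank x k i ≤ (c k).2)} := by
    ext x
    simp only [mem_ofPred_eq, Finset.ext_iff, mem_rankSelect]
    exact forall_congr' fun i => Iff.comm
  rw [this]
  refine measurableSet_setOfPred.2 (Measurable.forall fun i => Measurable.iff measurable_const
    (Measurable.forall fun k => Measurable.and ?_ ?_))
  · exact measurableSet_setOfPred.1 (measurableSet_lt measurable_const (measurable_coordRank k i))
  · exact measurableSet_setOfPred.1 (measurableSet_le (measurable_coordRank k i) measurable_const)

theorem coordCount_lt_iff (x : Fin n → EuclideanSpace ℝ (Fin d)) (k : Fin d) (i : Fin n) (a : ℝ) :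
    (∑ j, if x j k ≤ a then 1 else 0) < coordRank x k i ↔ a < x i k := by
  constructor
  · intro h
    by_contra hle
    refine absurd h (not_lt.2 (Finset.sum_le_sum fun j _ => ?_))
    split_ifs with h1 h2 <;> first | omega | (exfalso; linarith)
  · intro h
    refine Finset.sum_lt_sum (fun j _ => ?_) ⟨i, Finset.mem_univ i, ?_⟩
    · split_ifs with h1 h2 <;> first | omega | (exfalso; linarith)
    · simp [not_le.2 h]

theorem coordCount_le (x : Fin n → EuclideanSpace ℝ (Fin d)) (k : Fin d) (a : ℝ) :
    (∑ j, if x j k ≤ a then 1 else 0) < n + 1 := by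
  refine Nat.lt_succ_of_le ((Finset.sum_le_sum (g := fun _ => 1) fun j _ => ?_).trans (by simp))
  split_ifs <;> simp

theorem Cell.exists_mem_toSet_iff_mem_rankSelect (V : Cell d)
    (x : Fin n → EuclideanSpace ℝ (Fin d)) (hx : ∀ i, x i ∈ unitCube d) :
    ∃ c, ∀ i, x i ∈ V.toSet ↔ i ∈ rankSelect c x := by
  -- A coordinate exceeds a level exactly when its rank exceeds the number of points at or below
  -- that level. A side starting at `0` is closed there, so its lower rank bound is `0`, which every
  -- rank exceeds.
  refine ⟨fun k => (if V.lo k = 0 then 0 else ⟨_, coordCount_le x k (V.lo k)⟩,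
    ⟨_, coordCount_le x k (V.hi k)⟩), fun i => ?_⟩
  rw [mem_rankSelect]
  refine forall_congr' fun k => and_congr ?_ ?_
  · have h0 := (hx i k).1
    by_cases h : V.lo k = 0
    · have hpos : 0 < coordRank x k i :=
        Finset.sum_pos' (fun _ _ => Nat.zero_le _) ⟨i, Finset.mem_univ i, by simp⟩
      simp only [h, if_true, true_and, Fin.val_zero, hpos, iff_true]
      exact h0.lt_or_eq.imp_right Eq.symm
    · simp only [h, if_false, false_and, or_false]
      exact (coordCount_lt_iff x k i _).symm
  · have := coordCount_lt_iff x k i (V.hi k)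
    rw [← not_lt, ← this, not_lt]

theorem pi_measure_cell_noise_le (P : Measure (EuclideanSpace ℝ (Fin d) × ℝ))
    [IsProbabilityMeasure P] {e : EuclideanSpace ℝ (Fin d) × ℝ → ℝ} (he : Measurable e) {v : ℝ}
    (hv : 0 ≤ v)
    (hc : ∀ (t : ℝ) A, MeasurableSet A → ∫⁻ z in Prod.fst ⁻¹' A, ENNReal.ofReal
      (Real.exp (t * e z)) ∂P ≤ ENNReal.ofReal (Real.exp (v * t ^ 2 / 2)) * P (Prod.fst ⁻¹' A))
    {δ : ℝ} (hδ : 0 < δ) (hδ1 : δ < 1 / 3) :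
    (Measure.pi fun _ : Fin n => P) {z | ∃ c, √(2 * v * Real.log (((n : ℝ) + 1) ^ (2 * d) / δ) *
        (rankSelect c fun i => (z i).1).card) < |∑ i ∈ rankSelect c fun i => (z i).1, e (z i)|} ≤
      ENNReal.ofReal (2 * δ) := by
  have hpos : (0 : ℝ) < ((n : ℝ) + 1) ^ (2 * d) := by positivity
  have hl : 0 ≤ Real.log (((n : ℝ) + 1) ^ (2 * d) / δ) := by
    refine Real.log_nonneg ?_
    rw [le_div_iff₀ hδ]
    have : (1 : ℝ) ≤ ((n : ℝ) + 1) ^ (2 * d) :=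
      one_le_pow₀ (by linarith [Nat.cast_nonneg (α := ℝ) n])
    linarith
  rw [ofPred_exists]
  refine (measure_iUnion_fintype_le _ _).trans ((Finset.sum_le_sum fun c _ =>
    pi_measure_selected_noise_tail_le P he hv hc (rankSelect c)
      (measurableSet_rankSelect_eq c) hl).trans ?_)
  rw [Finset.sum_const, Finset.card_univ, nsmul_eq_mul, Real.exp_neg,
    Real.exp_log (div_pos hpos hδ)]
  have hcard : ((Fintype.card (Fin d → Fin (n + 1) × Fin (n + 1)) : ℕ) : ENNReal) =
      ENNReal.ofReal (((n : ℝ) + 1) ^ (2 * d)) := by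
    rw [← ENNReal.ofReal_natCast]
    congr 1
    simp [pow_mul, sq]
  -- Each rule fails with probability at most `2 * δ / (n + 1) ^ (2 * d)`, and the number of rules
  -- cancels the denominator.
  rw [hcard, show (2 : ENNReal) = ENNReal.ofReal 2 by simp, ← ENNReal.ofReal_mul (by norm_num),
    ← ENNReal.ofReal_mul hpos.le]
  refine ENNReal.ofReal_le_ofReal (le_of_eq ?_)
  field_simp

end Ranks

/-! ### Balanced cuts and the geometry of final cells. -/

theorem Finset.exists_balanced_threshold {ι : Type*} (S : Finset ι) {v : ι → ℝ}
    (hv : Function.Injective v) {m : ℕ} (hm : 1 ≤ m) (hS : 2 * m ≤ S.card) :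
    ∃ j ∈ S, m ≤ (S.filter fun i => v i ≤ v j).card ∧ m ≤ (S.filter fun i => v j < v i).card := by
  classical
  have hmax : ∀ R : Finset ι, R.Nonempty → ∃ j ∈ R, ∀ i ∈ R, v i ≤ v j := fun R hR =>
    R.exists_max_image v hR
  -- The `v`-least `j` in `F` works: fewer than `m` points lie strictly below it, so by injectivity
  -- at most `m` lie at or below, leaving at least `m` above.
  set F := S.filter fun j => m ≤ (S.filter fun i => v i ≤ v j).card with hF
  have hFne : F.Nonempty := by
    obtain ⟨j, hj, hjm⟩ := hmax S (Finset.card_pos.1 (by omega))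
    refine ⟨j, Finset.mem_filter.2 ⟨hj, ?_⟩⟩
    rw [Finset.filter_true_of_mem hjm]
    omega
  obtain ⟨j, hjF, hjmin⟩ := F.exists_min_image v hFne
  obtain ⟨hjS, hjm⟩ := Finset.mem_filter.1 hjF
  refine ⟨j, hjS, hjm, ?_⟩
  have hlt : (S.filter fun i => v i < v j).card < m := by
    by_contra hcon
    obtain ⟨j', hj', hj'm⟩ := hmax (S.filter fun i => v i < v j) (Finset.card_pos.1 (by omega))
    obtain ⟨hj'S, hj'lt⟩ := Finset.mem_filter.1 hj'
    refine absurd (hjmin j' (Finset.mem_filter.2 ⟨hj'S, ?_⟩)) (not_le.2 hj'lt)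
    refine (not_lt.1 hcon).trans (Finset.card_le_card fun i hi => ?_)
    exact Finset.mem_filter.2 ⟨(Finset.mem_filter.1 hi).1, hj'm i hi⟩
  have hle : (S.filter fun i => v i ≤ v j).card ≤ (S.filter fun i => v i < v j).card + 1 := by
    refine (Finset.card_le_card (t := insert j (S.filter fun i => v i < v j))
      fun i hi => ?_).trans (Finset.card_insert_le _ _)
    obtain ⟨hiS, hi⟩ := Finset.mem_filter.1 hi
    rcases hi.eq_or_lt with h | h
    · exact Finset.mem_insert.2 (Or.inl (hv h))
    · exact Finset.mem_insert_of_mem (Finset.mem_filter.2 ⟨hiS, h⟩)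
  have hsplit := Finset.card_filter_add_card_filter_not (s := S) fun i => v i ≤ v j
  simp only [not_le] at hsplit
  omega

theorem empCount_eq_card {d n : ℕ} (xs : Fin n → EuclideanSpace ℝ (Fin d))
    (A : Set (EuclideanSpace ℝ (Fin d))) [DecidablePred fun i => xs i ∈ A] :
    empCount xs A = ((Finset.univ.filter fun i => xs i ∈ A).card : ℝ) := by
  simp [empCount, indicator_apply]

theorem empCount_mono {d n : ℕ} (xs : Fin n → EuclideanSpace ℝ (Fin d))
    {A B : Set (EuclideanSpace ℝ (Fin d))} (h : A ⊆ B) : empCount xs A ≤ empCount xs B :=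
  Finset.sum_le_sum fun i _ => indicator_le_indicator_of_subset h (fun _ => zero_le_one) (xs i)

namespace Cell

variable {d n : ℕ}

theorem side_left (V : Cell d) (s : Fin d × ℝ) (k : Fin d) :
    (V.left s).side k = if k = s.1 then s.2 * V.side s.1 else V.side k := by
  by_cases h : k = s.1
  · subst h; simp [side, left, cut]
  · simp [side, left, h]

theorem side_right (V : Cell d) (s : Fin d × ℝ) (k : Fin d) :
    (V.right s).side k = if k = s.1 then (1 - s.2) * V.side s.1 else V.side k := by
  by_cases h : k = s.1
  · subst h; simp only [side, right, cut, Function.update_self, if_true]; ring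
  · simp [side, right, h]

theorem side_le_maxSide (V : Cell d) (k : Fin d) : V.side k ≤ V.maxSide :=
  le_ciSup (finite_range V.side).bddAbove k

theorem shapeRegular_iff (hd : 1 ≤ d) {β : ℝ} (hβ : 0 ≤ β) (V : Cell d) :
    V.ShapeRegular β ↔ ∀ j k, V.side j ≤ β * V.side k := by
  have : Nonempty (Fin d) := ⟨⟨0, hd⟩⟩
  constructor
  · intro h j k
    refine (V.side_le_maxSide j).trans (le_trans h (mul_le_mul_of_nonneg_left ?_ hβ))
    exact ciInf_le (finite_range V.side).bddBelow k
  · intro h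
    obtain ⟨k, hk⟩ := exists_eq_ciInf_of_finite (f := V.side)
    unfold ShapeRegular minSide maxSide
    rw [← hk]
    exact ciSup_le fun j => h j k

/-- The cell is a nondegenerate box inside `[0,1]^d`. -/
def InsideCube (V : Cell d) : Prop := ∀ k, 0 ≤ V.lo k ∧ V.lo k < V.hi k ∧ V.hi k ≤ 1

theorem InsideCube.side_pos {V : Cell d} (h : V.InsideCube) (k : Fin d) : 0 < V.side k :=
  sub_pos.2 (h k).2.1

theorem InsideCube.cut_mem {V : Cell d} (h : V.InsideCube) {s : Fin d × ℝ}
    (hs : s.2 ∈ Ioo (0 : ℝ) 1) : V.cut s ∈ Ioo (V.lo s.1) (V.hi s.1) := by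
  have := h.side_pos s.1
  have hside : V.hi s.1 = V.lo s.1 + V.side s.1 := by simp [side]
  constructor
  · have := mul_pos hs.1 this
    simp only [cut]; linarith
  · rw [hside]
    have := mul_lt_mul_of_pos_right hs.2 this
    simp only [cut]; linarith

theorem InsideCube.left {V : Cell d} (h : V.InsideCube) {s : Fin d × ℝ}
    (hs : s.2 ∈ Ioo (0 : ℝ) 1) : (V.left s).InsideCube := by
  intro k
  have hc := h.cut_mem hs
  by_cases hk : k = s.1
  · subst hk
    simp only [Cell.left, Function.update_self]
    exact ⟨(h _).1, hc.1, hc.2.le.trans (h _).2.2⟩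
  · simpa [Cell.left, hk] using h k

theorem InsideCube.right {V : Cell d} (h : V.InsideCube) {s : Fin d × ℝ}
    (hs : s.2 ∈ Ioo (0 : ℝ) 1) : (V.right s).InsideCube := by
  intro k
  have hc := h.cut_mem hs
  by_cases hk : k = s.1
  · subst hk
    simp only [Cell.right, Function.update_self]
    exact ⟨(h _).1.trans hc.1.le, hc.2, (h _).2.2⟩
  · simpa [Cell.right, hk] using h k

theorem InsideCube.toSet_subset {V : Cell d} (h : V.InsideCube) : V.toSet ⊆ unitCube d := by
  intro x hx k
  refine ⟨?_, (hx k).2.trans (h k).2.2⟩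
  rcases (hx k).1 with h1 | h1
  · exact (h k).1.trans h1.le
  · exact h1.2.ge

theorem halfOpenBox_subset_toSet (V : Cell d) : halfOpenBox V.lo V.hi ⊆ V.toSet :=
  fun _ hx k => ⟨Or.inl (hx k).1, (hx k).2⟩

theorem mem_toSet_left {V : Cell d} {s : Fin d × ℝ} {x : EuclideanSpace ℝ (Fin d)}
    (hx : x ∈ V.toSet) (h : x s.1 ≤ V.cut s) : x ∈ (V.left s).toSet := by
  refine fun k => ⟨(hx k).1, ?_⟩
  by_cases hk : k = s.1
  · subst hk; simpa [Cell.left] using h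
  · simpa [Cell.left, hk] using (hx k).2

theorem mem_toSet_right {V : Cell d} {s : Fin d × ℝ} {x : EuclideanSpace ℝ (Fin d)}
    (hx : x ∈ V.toSet) (h : V.cut s < x s.1) : x ∈ (V.right s).toSet := by
  refine fun k => ⟨?_, (hx k).2⟩
  by_cases hk : k = s.1
  · subst hk; left; simpa [Cell.right] using h
  · simpa [Cell.right, hk] using (hx k).1

/-- Every side of a child is at most twice the halved largest side; this is where `2 ≤ β` enters. -/
theorem shapeRegular_midpoint_children (hd : 1 ≤ d) {β : ℝ} (hβ : 2 ≤ β) {V : Cell d}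
    (hV : V.InsideCube) (hreg : V.ShapeRegular β) {s : Fin d × ℝ}
    (hs : V.side s.1 = V.maxSide) (hu : s.2 = 1 / 2) :
    (V.left s).ShapeRegular β ∧ (V.right s).ShapeRegular β := by
  have hβ0 : 0 ≤ β := by linarith
  rw [shapeRegular_iff hd hβ0] at hreg
  have key : ∀ W : Cell d, (∀ k, W.side k = if k = s.1 then 1 / 2 * V.side s.1 else V.side k) →
      W.ShapeRegular β := by
    intro W hW
    rw [shapeRegular_iff hd hβ0]
    intro j k
    have hpos := hV.side_pos s.1
    have hj : W.side j ≤ V.side j := by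
      rw [hW j]
      split_ifs with h
      · subst h; linarith
      · exact le_rfl
    refine hj.trans ?_
    rw [hW k]
    split_ifs with h
    · have := V.side_le_maxSide j
      rw [← hs] at this
      nlinarith
    · exact hreg j k
  refine ⟨key _ fun k => ?_, key _ fun k => ?_⟩
  · rw [side_left, hu]
  · rw [side_right, hu]; norm_num

theorem empCount_lt_of_countSplits_eq_empty (hd : 1 ≤ d) {V : Cell d} (hV : V.InsideCube)
    {xs : Fin n → EuclideanSpace ℝ (Fin d)} {m : ℕ} (hm : 1 ≤ m)
    (hinj : ∀ k, Function.Injective fun i => xs i k) (hne : ∀ i k, xs i k ≠ 0)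
    (hempty : V.countSplits xs m = ∅) : empCount xs V.toSet < 2 * m := by
  classical
  by_contra hcon
  rw [not_lt, empCount_eq_card] at hcon
  set S := Finset.univ.filter fun i => xs i ∈ V.toSet with hS
  set k : Fin d := ⟨0, hd⟩
  obtain ⟨j, hjS, hl, hr⟩ := S.exists_balanced_threshold (hinj k) hm (by exact_mod_cast hcon)
  have hjV : xs j ∈ V.toSet := (Finset.mem_filter.1 hjS).2
  -- The cut passes through a sample point, which goes left. It must be interior: coordinates are
  -- nonzero, and some point lies strictly above.
  have hlo : V.lo k < xs j k := (hjV k).1.resolve_right fun h => hne j k h.2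
  have hhi : xs j k < V.hi k := by
    obtain ⟨i, hi⟩ := Finset.card_pos.1 (hm.trans hr)
    obtain ⟨hiS, hi⟩ := Finset.mem_filter.1 hi
    exact hi.trans_le ((Finset.mem_filter.1 hiS).2 k).2
  have hpos := hV.side_pos k
  set s : Fin d × ℝ := (k, (xs j k - V.lo k) / V.side k) with hs
  have hcut : V.cut s = xs j k := by
    simp only [cut, hs]
    rw [div_mul_cancel₀ _ hpos.ne']
    ring
  have hmem : s ∈ V.countSplits xs m := by
    refine ⟨⟨div_pos (sub_pos.2 hlo) hpos, ?_⟩, ?_, ?_⟩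
    · rw [div_lt_one hpos]
      simp only [side]; linarith
    · rw [empCount_eq_card]
      refine Nat.cast_le.2 (hl.trans (Finset.card_le_card fun i hi => ?_))
      obtain ⟨hiS, hi⟩ := Finset.mem_filter.1 hi
      exact Finset.mem_filter.2 ⟨Finset.mem_univ i,
        mem_toSet_left (Finset.mem_filter.1 hiS).2 (hcut ▸ hi)⟩
    · rw [empCount_eq_card]
      refine Nat.cast_le.2 (hr.trans (Finset.card_le_card fun i hi => ?_))
      obtain ⟨hiS, hi⟩ := Finset.mem_filter.1 hi
      exact Finset.mem_filter.2 ⟨Finset.mem_univ i,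
        mem_toSet_right (Finset.mem_filter.1 hiS).2 (hcut ▸ hi)⟩
  rw [hempty] at hmem
  exact hmem

theorem norm_sub_le_of_mem {V : Cell d} {h : ℝ} (hside : ∀ k, V.side k ≤ h)
    (hlo : ∀ k, 0 ≤ V.lo k) {x y : EuclideanSpace ℝ (Fin d)} (hx : x ∈ V.toSet)
    (hy : y ∈ V.toSet) : ‖x - y‖ ≤ √d * h := by
  have hk : ∀ k, ‖(x - y) k‖ ≤ V.side k := by
    have hge : ∀ z ∈ V.toSet, ∀ k, V.lo k ≤ z k := by
      intro z hz k
      rcases (hz k).1 with h | h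
      · exact h.le
      · rw [h.1, h.2]
    intro k
    rw [PiLp.sub_apply, Real.norm_eq_abs, abs_le]
    have h1 := hge x hx k
    have h2 := hge y hy k
    have h3 := (hx k).2
    have h4 := (hy k).2
    constructor <;> simp only [side] <;> linarith
  rcases Nat.eq_zero_or_pos d with rfl | hd
  · simp [EuclideanSpace.norm_eq]
  have h0 : 0 ≤ h := (norm_nonneg _).trans ((hk ⟨0, hd⟩).trans (hside _))
  rw [EuclideanSpace.norm_eq]
  refine Real.sqrt_le_iff.2 ⟨by positivity, ?_⟩
  rw [mul_pow, Real.sq_sqrt (Nat.cast_nonneg d)]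
  refine (Finset.sum_le_sum fun k _ => pow_le_pow_left₀ (norm_nonneg _)
    ((hk k).trans (hside k)) 2).trans ?_
  simp

/-- The `d`-th power of the smallest side is at most the volume, and regularity compares every side
with the smallest. -/
theorem side_le_of_prod_le (hd : 1 ≤ d) {β q : ℝ} (hβ : 0 ≤ β) {V : Cell d} (hV : V.InsideCube)
    (hreg : V.ShapeRegular β) (hq : ∏ k, V.side k ≤ q) (k : Fin d) :
    V.side k ≤ β * q ^ (1 / (d : ℝ)) := by
  have : Nonempty (Fin d) := ⟨k⟩
  rw [shapeRegular_iff hd hβ] at hreg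
  obtain ⟨k₀, hk₀⟩ := Finite.exists_min V.side
  refine (hreg k k₀).trans (mul_le_mul_of_nonneg_left ?_ hβ)
  have hpow : V.side k₀ ^ d ≤ q := by
    refine le_trans ?_ hq
    have := Finset.prod_le_prod (s := Finset.univ) (f := fun _ : Fin d => V.side k₀)
      (g := V.side) (fun _ _ => (hV.side_pos k₀).le) fun i _ => hk₀ i
    simpa using this
  have h0 := (hV.side_pos k₀).le
  rw [← Real.pow_rpow_inv_natCast h0 (by omega : d ≠ 0), one_div]
  exact Real.rpow_le_rpow (by positivity) hpow (by positivity)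

end Cell

theorem SplitTree.leafCell_properties {d n : ℕ} (hd : 1 ≤ d)
    {xs : Fin n → EuclideanSpace ℝ (Fin d)} {m : ℕ} {β : ℝ} (hβ : 2 ≤ β)
    {M : Fin d × ℝ → Cell d → ℝ} (T : SplitTree d) (V : Cell d) (hcart : T.IsCart xs m β M V)
    (hsolv : T.Solvable xs m β M V) (hV : V.InsideCube) (hreg : V.ShapeRegular β)
    (hcount : (m : ℝ) ≤ empCount xs V.toSet) (x : EuclideanSpace ℝ (Fin d)) :
    (T.leafCell V x).InsideCube ∧ (T.leafCell V x).ShapeRegular β ∧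
      (m : ℝ) ≤ empCount xs (T.leafCell V x).toSet ∧
      (T.leafCell V x).countSplits xs m = ∅ := by
  induction T generalizing V with
  | leaf => exact ⟨hV, hreg, hcount, hcart⟩
  | node s l r ihl ihr =>
    obtain ⟨-, hchosen, hl, hr⟩ := hcart
    obtain ⟨hs, hsl, hsr⟩ := hsolv
    have key : s ∈ V.countSplits xs m ∧ (V.left s).ShapeRegular β ∧
        (V.right s).ShapeRegular β := by
      rcases hchosen with h | ⟨hno, hside, hu⟩
      · exact ⟨h.1.2, h.1.1.2⟩
      · exact ⟨hs.resolve_left hno, Cell.shapeRegular_midpoint_children hd hβ hV hreg hside hu⟩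
    obtain ⟨⟨hu, hml, hmr⟩, hregl, hregr⟩ := key
    unfold SplitTree.leafCell
    split_ifs with h
    · exact ihl _ hl hsl (hV.left hu) hregl hml
    · exact ihr _ hr hsr (hV.right hu) hregr hmr

/-! ### The deviation bound. -/

theorem HoldsWithProb.of_measure_compl_le {Ω : Type*} [MeasurableSpace Ω] {μ : Measure Ω}
    [IsProbabilityMeasure μ] {q : ℝ} (hq : 0 ≤ q) {A : Set Ω} (h : μ Aᶜ ≤ ENNReal.ofReal q) :
    HoldsWithProb μ (1 - q) A := by
  have hm := measurableSet_toMeasurable μ Aᶜ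
  refine ⟨(toMeasurable μ Aᶜ)ᶜ, compl_subset_comm.1 (subset_toMeasurable μ Aᶜ), hm.compl, ?_⟩
  rw [probReal_compl_eq_one_sub hm, measureReal_def, measure_toMeasurable]
  have := ENNReal.toReal_mono ENNReal.ofReal_ne_top h
  rw [ENNReal.toReal_ofReal hq] at this
  linarith

section LocalLip

variable {d : ℕ} {g : EuclideanSpace ℝ (Fin d) → ℝ} {V : Set (EuclideanSpace ℝ (Fin d))}
  {L : NNReal}

theorem localLip_nonneg : 0 ≤ localLip g V := Real.sInf_nonneg fun _ hK => hK.1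

theorem LipschitzOnWith.abs_sub_le (h : LipschitzOnWith L g V) :
    ∀ x ∈ V, ∀ y ∈ V, |g x - g y| ≤ L * ‖x - y‖ := by
  intro x hx y hy
  simpa [Real.dist_eq, dist_eq_norm] using h.dist_le_mul x hx y hy

theorem localLip_le (h : LipschitzOnWith L g V) : localLip g V ≤ L :=
  csInf_le ⟨0, fun _ hK => hK.1⟩ ⟨L.2, h.abs_sub_le⟩

/-- The infimum defining `localLip` is itself an admissible constant. -/
theorem abs_sub_le_localLip_mul (h : LipschitzOnWith L g V) {x y : EuclideanSpace ℝ (Fin d)}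
    (hx : x ∈ V) (hy : y ∈ V) : |g x - g y| ≤ localLip g V * ‖x - y‖ := by
  rcases (norm_nonneg (x - y)).eq_or_lt with h0 | h0
  · have := h.abs_sub_le x hx y hy
    rw [← h0, mul_zero] at this ⊢
    exact this
  · rw [← div_le_iff₀ h0]
    refine le_csInf ⟨L, L.2, h.abs_sub_le⟩ fun K hK => ?_
    rw [div_le_iff₀ h0]
    exact hK.2 x hx y hy

end LocalLip

theorem abs_localEstimator_sub_le {d n : ℕ} (xs : Fin n → EuclideanSpace ℝ (Fin d))
    (ys : Fin n → ℝ) (𝒱 : EuclideanSpace ℝ (Fin d) → Set (EuclideanSpace ℝ (Fin d)))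
    (x : EuclideanSpace ℝ (Fin d)) (g : EuclideanSpace ℝ (Fin d) → ℝ) {w : Finset (Fin n)}
    (hw : ∀ i, xs i ∈ 𝒱 x ↔ i ∈ w) {m : ℕ} (hm : 1 ≤ m) (hmw : m ≤ w.card) {c B : ℝ} (hc : 0 ≤ c)
    (hnoise : |∑ i ∈ w, (ys i - g (xs i))| ≤ √(c * w.card))
    (hbias : ∀ i ∈ w, |g (xs i) - g x| ≤ B) :
    |localEstimator xs ys 𝒱 x - g x| ≤ √(c / m) + B := by
  classical
  have hm' : (0 : ℝ) < m := by exact_mod_cast hm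
  have hmw' : (m : ℝ) ≤ w.card := by exact_mod_cast hmw
  have hN : (0 : ℝ) < w.card := hm'.trans_le hmw'
  have hest : localEstimator xs ys 𝒱 x = (∑ i ∈ w, ys i) / w.card := by
    simp [localEstimator, empCount, indicator_apply, hw]
  have hdecomp : localEstimator xs ys 𝒱 x - g x =
      (∑ i ∈ w, (ys i - g (xs i))) / w.card + (∑ i ∈ w, (g (xs i) - g x)) / w.card := by
    rw [hest, ← add_div, ← Finset.sum_add_distrib, eq_div_iff hN.ne', sub_mul,
      div_mul_cancel₀ _ hN.ne']
    simp [Finset.sum_sub_distrib, mul_comm]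
  rw [hdecomp]
  refine (abs_add_le _ _).trans (add_le_add ?_ ?_)
  · rw [abs_div, abs_of_pos hN, div_le_iff₀ hN]
    refine hnoise.trans ?_
    refine Real.sqrt_le_iff.2 ⟨by positivity, ?_⟩
    rw [mul_pow, Real.sq_sqrt (by positivity), div_mul_eq_mul_div, le_div_iff₀ hm', sq, ← mul_assoc]
    exact mul_le_mul_of_nonneg_left hmw' (by positivity)
  · rw [abs_div, abs_of_pos hN, div_le_iff₀ hN]
    refine (Finset.abs_sum_le_sum_abs _ _).trans ((Finset.sum_le_sum hbias).trans ?_)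
    rw [Finset.sum_const, nsmul_eq_mul, mul_comm]

theorem CartSetting.holdsWithProb_deviation {Ω : Type*} [MeasurableSpace Ω] {μ : Measure Ω}
    [IsProbabilityMeasure μ] {d n m : ℕ} {P : Measure (EuclideanSpace ℝ (Fin d) × ℝ)}
    [IsProbabilityMeasure P] {g : EuclideanSpace ℝ (Fin d) → ℝ} {σ : ℝ} {L : NNReal} {b β δ : ℝ}
    {X : Fin n → Ω → EuclideanSpace ℝ (Fin d)} {Y : Fin n → Ω → ℝ}
    {M : Ω → Fin d × ℝ → Cell d → ℝ} {T : Ω → SplitTree d} (hd : 1 ≤ d) (hδ : 0 < δ)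
    (hδ1 : δ < 1 / 3) (hm : 1 ≤ m) (hmn : m ≤ n)
    (hlog : 4 * Real.log (4 * (2 * (n : ℝ) + 1) ^ (2 * d) / δ) ≤ (m : ℝ))
    (S : CartSetting μ P g σ L b β m X Y M T) :
    HoldsWithProb μ (1 - 3 * δ)
      {ω | (T ω).Solvable (fun i => X i ω) m β (M ω) (Cell.root d) →
        ∀ x ∈ unitCube d,
          |localEstimator (fun i => X i ω) (fun i => Y i ω) (T ω).localMap x - g x| ≤
              Real.sqrt (2 * σ ^ 2 * Real.log (((n : ℝ) + 1) ^ (2 * d) / δ) / m) +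
                localLip g ((T ω).localMap x) * β * Real.sqrt d *
                  (5 * m / (n * b)) ^ (1 / (d : ℝ)) ∧
          localLip g ((T ω).localMap x) ≤ L} := by
  have hn : 1 ≤ n := hm.trans hmn
  have hn' : (0 : ℝ) < n := by exact_mod_cast hn
  have hm' : (0 : ℝ) < m := by exact_mod_cast hm
  have hβ := S.two_le_beta
  have hb := S.b_pos
  -- The globally Lipschitz extension is measurable and agrees with `g` wherever `X` has mass.
  obtain ⟨g', hg', hgg'⟩ := S.lipschitz.extend_real
  have hgae : (fun z => g z.1) =ᵐ[P] fun z => g' z.1 := by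
    have hP : IsProbabilityMeasure (P.map Prod.fst) :=
      Measure.isProbabilityMeasure_map measurable_fst.aemeasurable
    have : ∀ᵐ p ∂P, p.1 ∈ unitCube d :=
      ae_of_ae_map measurable_fst.aemeasurable (p := fun x => x ∈ unitCube d)
        ((mem_ae_iff_prob_eq_one (measurableSet_unitCube d)).2 S.density.map_unitCube)
    filter_upwards [this] with z hz using hgg' hz
  have he : Measurable fun z : EuclideanSpace ℝ (Fin d) × ℝ => z.2 - g' z.1 :=
    measurable_snd.sub (hg'.continuous.measurable.comp measurable_fst)
  set l := Real.log (((n : ℝ) + 1) ^ (2 * d) / δ) with hl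
  have hl0 : 0 ≤ l := by
    refine Real.log_nonneg ?_
    rw [le_div_iff₀ hδ]
    have : (1 : ℝ) ≤ ((n : ℝ) + 1) ^ (2 * d) := one_le_pow₀ (by linarith)
    linarith
  have hnoise := pi_measure_cell_noise_le (n := n) P he (sq_nonneg σ)
    (fun t A hA => S.noise.setLIntegral_exp_le hgae t A hA) hδ hδ1
  have hmass := pi_measure_light_box_heavy_mass_le (n := n) (m := m) P S.density.coordinate_null
    S.density.map_unitCube hδ hδ1 hn hlog
  rw [← hl] at hnoise
  set B₁ := {z : Fin n → EuclideanSpace ℝ (Fin d) × ℝ | ∃ c, √(2 * σ ^ 2 * l *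
    (rankSelect c fun i => (z i).1).card) <
      |∑ i ∈ rankSelect c fun i => (z i).1, ((z i).2 - g' (z i).1)|} with hB₁
  set B₂ := {z : Fin n → EuclideanSpace ℝ (Fin d) × ℝ | ∃ lo hi : Fin d → ℝ,
      empCount (fun i => (z i).1) (halfOpenBox lo hi) ≤ 2 * m ∧
        5 * m / n < (P.map Prod.fst).real (halfOpenBox lo hi)} with hB₂
  set Z : Ω → Fin n → EuclideanSpace ℝ (Fin d) × ℝ := fun ω i => (X i ω, Y i ω) with hZ
  have hZm : AEMeasurable Z μ := aemeasurable_pi_lambda _ fun i => (S.law i).aemeasurable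
  have hmap : μ.map Z = Measure.pi fun _ => P := by
    rw [(iIndepFun_iff_map_fun_eq_pi_map fun i => (S.law i).aemeasurable).1 S.indep]
    congr 1
    funext i
    exact (S.law i).map_eq
  have hcube := ae_of_ae_map hZm (hmap ▸ ae_pi_fst_mem_unitCube S.density n)
  have hne := ae_of_ae_map hZm (hmap ▸ ae_pi_fst_ne S.density n 0)
  have hinj := ae_of_ae_map hZm (hmap ▸ ae_pi_fst_injective S.density n)
  refine HoldsWithProb.of_measure_compl_le (by positivity) ?_
  refine (measure_mono_ae (t := Z ⁻¹' (B₁ ∪ B₂)) ?_).trans ?_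
  swap
  -- This inequality holds for arbitrary sets, so the exceptional events need not be shown
  -- measurable.
  · refine (Measure.le_map_apply hZm _).trans ?_
    rw [hmap]
    refine (measure_union_le _ _).trans ((add_le_add hnoise hmass).trans (le_of_eq ?_))
    rw [← ENNReal.ofReal_add (by positivity) hδ.le]
    ring_nf
  filter_upwards [hcube, hne, hinj, S.tree] with ω hcube hne hinj htree hω
  by_contra hgood
  refine hω fun hsolv x hx => ?_
  have hgood₁ : Z ω ∉ B₁ := fun h => hgood (Or.inl h)
  have hgood₂ : Z ω ∉ B₂ := fun h => hgood (Or.inr h)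
  set xs : Fin n → EuclideanSpace ℝ (Fin d) := fun i => X i ω with hxs
  set V := (T ω).leafCell (Cell.root d) x with hV
  have hroot : (Cell.root d).InsideCube := fun k => by simp [Cell.root]
  have hrootreg : (Cell.root d).ShapeRegular β := by
    rw [Cell.shapeRegular_iff hd (by linarith)]
    intro j k
    simp only [Cell.side, Cell.root]
    linarith
  have hrootcount : (m : ℝ) ≤ empCount xs (Cell.root d).toSet := by
    classical
    rw [Cell.toSet_root, empCount_eq_card, Finset.filter_true_of_mem fun i _ => hcube i]
    simpa using hmn
  obtain ⟨hin, hreg, hcount, hempty⟩ := (T ω).leafCell_properties hd hβ (Cell.root d) htree hsolv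
    hroot hrootreg hrootcount x
  have hlt := Cell.empCount_lt_of_countSplits_eq_empty hd hin hm hinj hne hempty
  have hVsub := hin.toSet_subset
  have hboxcount : empCount xs (halfOpenBox V.lo V.hi) ≤ 2 * m :=
    (empCount_mono xs V.halfOpenBox_subset_toSet).trans hlt.le
  have hboxmass : (P.map Prod.fst).real (halfOpenBox V.lo V.hi) ≤ 5 * m / n :=
    not_lt.1 fun h => hgood₂ ⟨V.lo, V.hi, hboxcount, h⟩
  have hprod : ∏ k, V.side k ≤ 5 * m / (n * b) := by
    have h := (S.density.le_measureReal_box hb.le (fun k => (hin k).2.1.le)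
      (V.halfOpenBox_subset_toSet.trans hVsub)).trans hboxmass
    rw [← div_div, le_div_iff₀ hb, mul_comm]
    exact h
  have hside := Cell.side_le_of_prod_le hd (by linarith) hin hreg hprod
  have hxV : x ∈ V.toSet := (T ω).mem_localMap x hx
  have hlip : LipschitzOnWith L g V.toSet := S.lipschitz.mono hVsub
  refine ⟨?_, localLip_le hlip⟩
  obtain ⟨c, hc⟩ := V.exists_mem_toSet_iff_mem_rankSelect xs hcube
  refine abs_localEstimator_sub_le xs (fun i => Y i ω) (T ω).localMap x g (w := rankSelect c xs)
    hc hm ?_ (by positivity) ?_ ?_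
  · classical
    rw [empCount_eq_card] at hcount
    refine (Nat.cast_le.1 hcount).trans (Finset.card_le_card fun i hi => ?_)
    exact (hc i).1 (Finset.mem_filter.1 hi).2
  · have h := not_lt.1 fun h => hgood₁ ⟨c, h⟩
    refine le_trans (le_of_eq ?_) h
    congr 1
    exact Finset.sum_congr rfl fun i _ => by rw [hgg' (hcube i)]
  · intro i hi
    refine (abs_sub_le_localLip_mul hlip ((hc i).2 hi) hxV).trans ?_
    have := Cell.norm_sub_le_of_mem hside (fun k => (hin k).1) ((hc i).2 hi) hxV
    calc _ ≤ localLip g V.toSet * (√d * (β * (5 * m / (n * b)) ^ (1 / (d : ℝ)))) :=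
          mul_le_mul_of_nonneg_left this localLip_nonneg
      _ = _ := by
          rw [SplitTree.localMap]
          ring

/-! ### The rate in sup-norm. -/

theorem one_le_log_pow_div {d n : ℕ} {δ : ℝ} (hδ : 0 < δ) (hδ1 : δ < 1 / 3) :
    1 ≤ Real.log (((n : ℝ) + 1) ^ (2 * d) / δ) := by
  have h1 : (1 : ℝ) ≤ ((n : ℝ) + 1) ^ (2 * d) :=
    one_le_pow₀ (by linarith [Nat.cast_nonneg (α := ℝ) n])
  rw [Real.le_log_iff_exp_le (by positivity), le_div_iff₀ hδ]
  nlinarith [Real.exp_one_lt_d9, Real.exp_pos 1]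

theorem tendsto_log_pow_div_div_atTop (d : ℕ) {δ : ℝ} (hδ : 0 < δ) :
    Filter.Tendsto (fun n : ℕ => Real.log (((n : ℝ) + 1) ^ (2 * d) / δ) / n) Filter.atTop
      (nhds 0) := by
  have hlog : Filter.Tendsto (fun n : ℕ => Real.log ((n : ℝ) + 1) / n) Filter.atTop (nhds 0) := by
    have h1 : Filter.Tendsto (fun x : ℝ => Real.log x / (x - 1)) Filter.atTop (nhds 0) := by
      simpa [sub_eq_add_neg] using Real.tendsto_pow_log_div_mul_add_atTop 1 (-1) 1 one_ne_zero
    have h2 : Filter.Tendsto (fun n : ℕ => (n : ℝ) + 1) Filter.atTop Filter.atTop :=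
      Filter.tendsto_atTop_add_const_right _ _ tendsto_natCast_atTop_atTop
    simpa [Function.comp_def] using h1.comp h2
  have hconst : Filter.Tendsto (fun n : ℕ => Real.log δ / (n : ℝ)) Filter.atTop (nhds 0) :=
    tendsto_const_nhds.div_atTop tendsto_natCast_atTop_atTop
  have := (hlog.const_mul ((2 * d : ℕ) : ℝ)).sub hconst
  rw [mul_zero, sub_zero] at this
  refine this.congr fun n => ?_
  rw [Real.log_div (by positivity) hδ.ne', Real.log_pow]
  ring

/-- Reduces the lower bound required of `m` to `8 * l`. The condition `3 ≤ n` gives `4 * 4 ^ d ≤ (n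
+ 1) ^ (2 * d)`, which absorbs the constants. -/
theorem log_shatter_le {d n : ℕ} {δ : ℝ} (hd : 1 ≤ d) (hδ : 0 < δ) (hδ1 : δ < 1 / 3)
    (hn : 3 ≤ n) : Real.log (4 * (2 * (n : ℝ) + 1) ^ (2 * d) / δ) ≤
      2 * Real.log (((n : ℝ) + 1) ^ (2 * d) / δ) := by
  have hn' : (3 : ℝ) ≤ n := by exact_mod_cast hn
  rw [← Nat.cast_ofNat (R := ℝ) (n := 2), ← Real.log_pow, Nat.cast_ofNat]
  refine Real.log_le_log (by positivity) ?_
  have h4 : (4 : ℝ) ≤ 4 ^ d := le_self_pow₀ (by norm_num) (by omega)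
  have h1 : (2 * (n : ℝ) + 1) ^ (2 * d) ≤ 4 ^ d * ((n : ℝ) + 1) ^ (2 * d) := by
    calc (2 * (n : ℝ) + 1) ^ (2 * d) ≤ (2 * ((n : ℝ) + 1)) ^ (2 * d) :=
          pow_le_pow_left₀ (by positivity) (by linarith) _
      _ = _ := by rw [mul_pow, pow_mul 2]; norm_num
  have h2 : (4 : ℝ) * 4 ^ d ≤ ((n : ℝ) + 1) ^ (2 * d) := by
    calc (4 : ℝ) * 4 ^ d ≤ 4 ^ d * 4 ^ d := mul_le_mul_of_nonneg_right h4 (by positivity)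
      _ = 4 ^ (2 * d) := by rw [← pow_add, two_mul]
      _ ≤ _ := pow_le_pow_left₀ (by norm_num) (by linarith) _
  set p := ((n : ℝ) + 1) ^ (2 * d) with hp
  have hp0 : 0 < p := by positivity
  have h3 : 4 * (2 * (n : ℝ) + 1) ^ (2 * d) ≤ p * p := by
    calc 4 * (2 * (n : ℝ) + 1) ^ (2 * d) ≤ 4 * 4 ^ d * p := by linarith
      _ ≤ p * p := mul_le_mul_of_nonneg_right h2 hp0.le
  rw [div_pow, sq p, sq δ, div_le_div_iff₀ hδ (by positivity)]
  calc _ ≤ p * p * (δ * δ) := mul_le_mul_of_nonneg_right h3 (by positivity)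
    _ ≤ p * p * δ := mul_le_mul_of_nonneg_left (by nlinarith) (by positivity)

theorem eventually_mul_rpow_le {ρ : ℕ → ℝ} (hρ : Filter.Tendsto ρ Filter.atTop (nhds 0)) {p : ℝ}
    (hp : 0 < p) (c : ℝ) {a : ℝ} (ha : 0 < a) : ∀ᶠ n in Filter.atTop, c * ρ n ^ p ≤ a := by
  have h := (hρ.rpow_const (Or.inr hp.le)).const_mul c
  rw [Real.zero_rpow hp.ne', mul_zero] at h
  exact (h.eventually_lt_const ha).mono fun _ h => h.le

theorem CartSetting.holdsWithProb_rate {Ω : Type*} [MeasurableSpace Ω] {μ : Measure Ω}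
    [IsProbabilityMeasure μ] {d n m : ℕ} {P : Measure (EuclideanSpace ℝ (Fin d) × ℝ)}
    [IsProbabilityMeasure P] {g : EuclideanSpace ℝ (Fin d) → ℝ} {σ : ℝ} {L : NNReal} {b β δ : ℝ}
    {X : Fin n → Ω → EuclideanSpace ℝ (Fin d)} {Y : Fin n → Ω → ℝ}
    {M : Ω → Fin d × ℝ → Cell d → ℝ} {T : Ω → SplitTree d} {a₁ a₂ : ℝ} (ha₁ : 0 < a₁)
    (ha₂ : 0 < a₂) (hd : 1 ≤ d) (hδ : 0 < δ) (hδ1 : δ < 1 / 3) (hn : 3 ≤ n)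
    (hsmall₁ : 8 * (Real.log (((n : ℝ) + 1) ^ (2 * d) / δ) / n) ^ (2 / ((d : ℝ) + 2)) ≤ a₁)
    (hsmall₂ : a₂ * (Real.log (((n : ℝ) + 1) ^ (2 * d) / δ) / n) ^ ((d : ℝ) / ((d : ℝ) + 2)) ≤ 1)
    (hm₁ : a₁ * ((n : ℝ) ^ (2 / ((d : ℝ) + 2)) *
      Real.log (((n : ℝ) + 1) ^ (2 * d) / δ) ^ ((d : ℝ) / ((d : ℝ) + 2))) ≤ (m : ℝ))
    (hm₂ : (m : ℝ) ≤ a₂ * ((n : ℝ) ^ (2 / ((d : ℝ) + 2)) *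
      Real.log (((n : ℝ) + 1) ^ (2 * d) / δ) ^ ((d : ℝ) / ((d : ℝ) + 2))))
    (S : CartSetting μ P g σ L b β m X Y M T) :
    HoldsWithProb μ (1 - 3 * δ)
      {ω | (T ω).Solvable (fun i => X i ω) m β (M ω) (Cell.root d) →
        ∀ x ∈ unitCube d,
          |localEstimator (fun i => X i ω) (fun i => Y i ω) (T ω).localMap x - g x| ≤
            (1 / √a₁ + max 1 a₂) *
              (Real.sqrt (2 * σ ^ 2) + β * L * Real.sqrt d * (5 / b) ^ (1 / (d : ℝ))) *
              (Real.log (((n : ℝ) + 1) ^ (2 * d) / δ) / n) ^ (1 / ((d : ℝ) + 2))} := by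
  have hn' : (0 : ℝ) < n := by exact_mod_cast (by omega : 0 < n)
  have hd' : (1 : ℝ) ≤ d := by exact_mod_cast hd
  have hlog := log_shatter_le hd hδ hδ1 hn
  have hl1 := one_le_log_pow_div (d := d) (n := n) hδ hδ1
  have hb := S.b_pos
  have hβ := S.two_le_beta
  have hshatter : 0 < Real.log (4 * (2 * (n : ℝ) + 1) ^ (2 * d) / δ) := by
    refine Real.log_pos ?_
    rw [lt_div_iff₀ hδ]
    have : (1 : ℝ) ≤ (2 * (n : ℝ) + 1) ^ (2 * d) := one_le_pow₀ (by linarith)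
    linarith
  have hdev := fun h1 h2 h3 => S.holdsWithProb_deviation hd hδ hδ1 h1 h2 h3
  set l := Real.log (((n : ℝ) + 1) ^ (2 * d) / δ) with hl
  have hl0 : 0 < l := by linarith
  set ρ := l / n with hρ
  have hρ0 : 0 < ρ := by positivity
  set r := (n : ℝ) ^ (2 / ((d : ℝ) + 2)) * l ^ ((d : ℝ) / ((d : ℝ) + 2)) with hr
  have hr0 : 0 < r := by positivity
  have hexp : 2 / ((d : ℝ) + 2) + (d : ℝ) / ((d : ℝ) + 2) = 1 := by field_simp; ring
  have hrn : r = n * ρ ^ ((d : ℝ) / ((d : ℝ) + 2)) := by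
    rw [hr, hρ, Real.div_rpow hl0.le hn'.le]
    nth_rewrite 2 [← Real.rpow_one (n : ℝ)]
    rw [← hexp, Real.rpow_add hn']
    field_simp
  -- With `a₁ * r ≤ m` and `hsmall₁` this yields `8 * l ≤ m`; the formula for `r` and `hsmall₂`
  -- yield `m ≤ n`.
  have hlr : l = r * ρ ^ (2 / ((d : ℝ) + 2)) := by
    rw [hrn, mul_assoc, ← Real.rpow_add hρ0, add_comm, hexp, Real.rpow_one, hρ]
    field_simp
  have h8 : 8 * l ≤ m := by
    refine le_trans ?_ hm₁
    rw [hlr]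
    nlinarith
  have hm0 : (0 : ℝ) < m := by linarith
  have hmn : (m : ℝ) ≤ n := by
    refine hm₂.trans ?_
    rw [hrn]
    nlinarith
  obtain ⟨E, hE, hEm, hEp⟩ := hdev (by exact_mod_cast hm0) (by exact_mod_cast hmn) (by linarith)
  refine ⟨E, fun ω hω hsolv x hx => ?_, hEm, hEp⟩
  obtain ⟨hbound, hL⟩ := hE hω hsolv x hx
  refine hbound.trans ?_
  set t := ρ ^ (1 / ((d : ℝ) + 2)) with ht
  have ht0 : 0 ≤ t := by positivity
  have hvar : √(2 * σ ^ 2 * l / m) ≤ 1 / √a₁ * √(2 * σ ^ 2) * t := by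
    have hsq : ρ ^ (2 / ((d : ℝ) + 2)) = t ^ 2 := by
      rw [ht, ← Real.rpow_natCast, ← Real.rpow_mul hρ0.le]
      congr 1
      push_cast
      ring
    have hlm : l / m ≤ t ^ 2 / a₁ := by
      rw [div_le_div_iff₀ hm0 ha₁, ← hsq]
      calc l * a₁ = ρ ^ (2 / ((d : ℝ) + 2)) * (a₁ * r) := by rw [hlr]; ring
        _ ≤ _ := mul_le_mul_of_nonneg_left hm₁ (by positivity)
    calc √(2 * σ ^ 2 * l / m) ≤ √(2 * σ ^ 2 * (t ^ 2 / a₁)) := by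
          refine Real.sqrt_le_sqrt ?_
          rw [mul_div_assoc]
          exact mul_le_mul_of_nonneg_left hlm (by positivity)
      _ = _ := by
          rw [Real.sqrt_mul (by positivity), Real.sqrt_div (by positivity), Real.sqrt_sq ht0]
          ring
  have hbias : (5 * m / (n * b)) ^ (1 / (d : ℝ)) ≤ (5 / b) ^ (1 / (d : ℝ)) * (max 1 a₂ * t) := by
    have hle : 5 * m / (n * b) ≤ 5 / b * (a₂ * ρ ^ ((d : ℝ) / ((d : ℝ) + 2))) := by
      have : (m : ℝ) / n ≤ a₂ * ρ ^ ((d : ℝ) / ((d : ℝ) + 2)) := by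
        rw [div_le_iff₀ hn']
        refine hm₂.trans (le_of_eq ?_)
        rw [hrn]; ring
      calc 5 * (m : ℝ) / (n * b) = 5 / b * (m / n) := by field_simp
        _ ≤ _ := mul_le_mul_of_nonneg_left this (by positivity)
    refine (Real.rpow_le_rpow (by positivity) hle (by positivity)).trans ?_
    rw [Real.mul_rpow (by positivity) (by positivity), Real.mul_rpow ha₂.le (by positivity),
      ← Real.rpow_mul hρ0.le]
    have hpow : (d : ℝ) / ((d : ℝ) + 2) * (1 / (d : ℝ)) = 1 / ((d : ℝ) + 2) := by field_simp
    -- Removes the dimension from the constant, which may depend only on `a₁` and `a₂`.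
    have ha : a₂ ^ (1 / (d : ℝ)) ≤ max 1 a₂ := by
      calc a₂ ^ (1 / (d : ℝ)) ≤ (max 1 a₂) ^ (1 / (d : ℝ)) :=
            Real.rpow_le_rpow ha₂.le (le_max_right _ _) (by positivity)
        _ ≤ (max 1 a₂) ^ (1 : ℝ) := Real.rpow_le_rpow_of_exponent_le (le_max_left _ _)
            (div_le_one_of_le₀ hd' (by positivity))
        _ = _ := Real.rpow_one _
    rw [hpow]
    gcongr
  have hbias' : localLip g ((T ω).localMap x) * β * √d * (5 * m / (n * b)) ^ (1 / (d : ℝ)) ≤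
      max 1 a₂ * (β * L * √d * (5 / b) ^ (1 / (d : ℝ))) * t := by
    calc _ ≤ L * β * √d * ((5 / b) ^ (1 / (d : ℝ)) * (max 1 a₂ * t)) := by
          have : (0 : ℝ) ≤ localLip g ((T ω).localMap x) := localLip_nonneg
          have : (0 : ℝ) ≤ β := by linarith
          gcongr
      _ = _ := by ring
  have hmax : 0 ≤ max 1 a₂ := le_max_of_le_left zero_le_one
  have hβ0 : 0 ≤ β := by linarith
  have hc1 : 0 ≤ max 1 a₂ * √(2 * σ ^ 2) * t := by positivity
  have hc2 : 0 ≤ 1 / √a₁ * (β * L * √d * (5 / b) ^ (1 / (d : ℝ))) * t := by positivity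
  -- Adding the two nonnegative cross terms factors the bound with the single constant `1 / √a₁ +
  -- max 1 a₂`.
  calc _ ≤ _ := add_le_add hvar hbias'
    _ ≤ 1 / √a₁ * √(2 * σ ^ 2) * t + max 1 a₂ * (β * L * √d * (5 / b) ^ (1 / (d : ℝ))) * t +
        (max 1 a₂ * √(2 * σ ^ 2) * t +
          1 / √a₁ * (β * L * √d * (5 / b) ^ (1 / (d : ℝ))) * t) := by linarith
    _ = _ := by ring

theorem mainTheorem8 :
    -- the deviation bound
    (∀ (Ω : Type u) [MeasurableSpace Ω] (μ : Measure Ω) [IsProbabilityMeasure μ]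
        (d n m : ℕ) (P : Measure (EuclideanSpace ℝ (Fin d) × ℝ)) [IsProbabilityMeasure P]
        (g : EuclideanSpace ℝ (Fin d) → ℝ) (σ : ℝ) (L : NNReal) (b β δ : ℝ)
        (X : Fin n → Ω → EuclideanSpace ℝ (Fin d)) (Y : Fin n → Ω → ℝ)
        (M : Ω → Fin d × ℝ → Cell d → ℝ) (T : Ω → SplitTree d),
      1 ≤ d → 0 < δ → δ < 1 / 3 → 1 ≤ m → m ≤ n →
      4 * Real.log (4 * (2 * (n : ℝ) + 1) ^ (2 * d) / δ) ≤ (m : ℝ) →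
      CartSetting μ P g σ L b β m X Y M T →
      HoldsWithProb μ (1 - 3 * δ)
        {ω | (T ω).Solvable (fun i => X i ω) m β (M ω) (Cell.root d) →
          ∀ x ∈ unitCube d,
            |localEstimator (fun i => X i ω) (fun i => Y i ω) (T ω).localMap x - g x| ≤
                Real.sqrt (2 * σ ^ 2 * Real.log (((n : ℝ) + 1) ^ (2 * d) / δ) / m) +
                  localLip g ((T ω).localMap x) * β * Real.sqrt d *
                    (5 * m / (n * b)) ^ (1 / (d : ℝ)) ∧
            localLip g ((T ω).localMap x) ≤ L}) ∧
    -- the rate in sup-norm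
    (∀ a₁ a₂ : ℝ, 0 < a₁ → 0 < a₂ → ∃ C : ℝ, 0 < C ∧
      ∀ (d : ℕ) (δ : ℝ), 1 ≤ d → 0 < δ → δ < 1 / 3 → ∃ n₀ : ℕ,
      ∀ (Ω : Type u) [MeasurableSpace Ω] (μ : Measure Ω) [IsProbabilityMeasure μ]
        (n m : ℕ) (P : Measure (EuclideanSpace ℝ (Fin d) × ℝ)) [IsProbabilityMeasure P]
        (g : EuclideanSpace ℝ (Fin d) → ℝ) (σ : ℝ) (L : NNReal) (b β : ℝ)
        (X : Fin n → Ω → EuclideanSpace ℝ (Fin d)) (Y : Fin n → Ω → ℝ)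
        (M : Ω → Fin d × ℝ → Cell d → ℝ) (T : Ω → SplitTree d),
      n₀ ≤ n →
      a₁ * ((n : ℝ) ^ (2 / ((d : ℝ) + 2)) *
        Real.log (((n : ℝ) + 1) ^ (2 * d) / δ) ^ ((d : ℝ) / ((d : ℝ) + 2))) ≤ (m : ℝ) →
      (m : ℝ) ≤ a₂ * ((n : ℝ) ^ (2 / ((d : ℝ) + 2)) *
        Real.log (((n : ℝ) + 1) ^ (2 * d) / δ) ^ ((d : ℝ) / ((d : ℝ) + 2))) →
      CartSetting μ P g σ L b β m X Y M T →
      HoldsWithProb μ (1 - 3 * δ)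
        {ω | (T ω).Solvable (fun i => X i ω) m β (M ω) (Cell.root d) →
          ∀ x ∈ unitCube d,
            |localEstimator (fun i => X i ω) (fun i => Y i ω) (T ω).localMap x - g x| ≤
              C * (Real.sqrt (2 * σ ^ 2) + β * L * Real.sqrt d * (5 / b) ^ (1 / (d : ℝ))) *
                (Real.log (((n : ℝ) + 1) ^ (2 * d) / δ) / n) ^ (1 / ((d : ℝ) + 2))}) := by
  refine ⟨?_, ?_⟩
  · intro Ω _ μ _ d n m P _ g σ L b β δ X Y M T hd hδ hδ1 hm hmn hlog S
    exact S.holdsWithProb_deviation hd hδ hδ1 hm hmn hlog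
  · intro a₁ a₂ ha₁ ha₂
    refine ⟨1 / √a₁ + max 1 a₂, by positivity, fun d δ hd hδ hδ1 => ?_⟩
    have hd' : (0 : ℝ) < d := by exact_mod_cast hd
    have hρ := tendsto_log_pow_div_div_atTop d hδ
    obtain ⟨n₀, hn₀⟩ := Filter.eventually_atTop.1
      ((eventually_mul_rpow_le hρ (by positivity : 0 < 2 / ((d : ℝ) + 2)) 8 ha₁).and
        ((eventually_mul_rpow_le hρ (by positivity : 0 < (d : ℝ) / ((d : ℝ) + 2)) a₂
          one_pos).and (Filter.eventually_ge_atTop 3)))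
    refine ⟨n₀, ?_⟩
    intro Ω _ μ _ n m P _ g σ L b β X Y M T hn hm₁ hm₂ S
    obtain ⟨h1, h2, h3⟩ := hn₀ n hn
    exact S.holdsWithProb_rate ha₁ ha₂ hd hδ hδ1 h3 h1 h2 hm₁ hm₂
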